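/- Let $\mathbb{A}$ be a small category. For a presheaf $Y:\mathbb{A}^{\mathrm{op}}\to\mathbf{Set}$ and a functor $X:\mathbb{A}\to\mathcal{E}$, where $\mathcal{E}$ is $\mathbf{Set}$ or the category $\mathbf{Top}$ of all topological spaces, let $Y\otimes X=\int^{b}Y(b)\times X(b)$ be the quotient of $\sum_{b}Y(b)\times X(b)$ by the equivalence relation generated by $(yg,x)\sim(y,gx)$ for $g:b'\to b$, $y\in Y(b)$, $x\in X(b')$ (for $\mathcal{E}=\mathbf{Top}$, $Y(b)$ is discrete and the quotient topology is used). A functor $X:\mathbb{A}\to\mathbf{Set}$ is *nondegenerate* if $-\otimes X:[\mathbb{A}^{\mathrm{op}},\mathbf{Set}]\to\mathbf{Set}$ preserves finite connected limits. A functor $X:\mathbb{A}\to\mathbf{Top}$ is nondegenerate if its underlying $\mathbf{Set}$-valued functor is nondegenerate and $Xf$ is a closed map for every morphism $f$ of $\mathbb{A}$. An *equational system* $(\mathbb{A},M)$ is a small category $\mathbb{A}$ together with a functor $M:\mathbb{A}^{\mathrm{op}}\times\mathbb{A}\to\mathbf{Set}$ such that for each $a$ the category of elements of $M(-,a)$ is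 finite (finitely many objects and morphisms), and for each $b$ the functor $M(b,-)$ is nondegenerate. For $X:\mathbb{A}\to\mathbf{Top}$ put $(M\otimes X)(a)=M(-,a)\otimes X$. An *$M$-coalgebra* in $\mathbf{Top}$ is a nondegenerate functor $X:\mathbb{A}\to\mathbf{Top}$ with a natural transformation $\xi:X\to M\otimes X$; a map $(X,\xi)\to(X',\xi')$ of $M$-coalgebras is a natural transformation $\alpha:X\to X'$ with $\xi'\circ\alpha=(M\otimes\alpha)\circ\xi$. A *universal solution* of $(\mathbb{A},M)$ is a terminal object $(I,\iota)$ of the category of $M$-coalgebras in $\mathbf{Top}$ (it need not exist). A topological space $S$ is *realizable* if there are an equational system $(\mathbb{A},M)$ having a universal solution $(I,\iota)$ in $\mathbf{Top}$ and an object $a\in\mathbb{A}$ such that $S$ is homeomorphic to $I(a)$. **Theorem (Realizability).** A topological space is realizable if and only if it is compact and metrizable. -/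

import Mathlib

open CategoryTheory Opposite Limits

universe u

namespace SelfSimilarity

section Tensor

variable {B : Type u} [SmallCategory B]

/-- The relation `(y g, x) ∼ (y, g x)`, for `g : b' ⟶ b`, `y ∈ Y(b)` and `x ∈ X(b')`, on the
disjoint union of the sets `Y(b) × X(b)`. This disjoint union is written as the disjoint union of
copies of the sets `X(b)`, indexed by all pairs `(b, y)` with `y ∈ Y(b)`. -/
inductive TensorRel (Y : Bᵒᵖ ⥤ Type u) (X : B ⥤ Type u) :
    (Σ p : (Σ b : B, Y.obj (op b)), X.obj p.1) →
      (Σ p : (Σ b : B, Y.obj (op b)), X.obj p.1) → Prop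
  | mk {b' b : B} (g : b' ⟶ b) (y : Y.obj (op b)) (x : X.obj b') :
      TensorRel Y X ⟨⟨b', Y.map g.op y⟩, x⟩ ⟨⟨b, y⟩, X.map g x⟩

/-- The tensor product `Y ⊗ X`, that is the coend `∫^b Y(b) × X(b)`, of a presheaf `Y` and a
set-valued functor `X`: the quotient of `∑ b, Y(b) × X(b)` by the equivalence relation generated
by `(y g, x) ∼ (y, g x)`. -/
def Tensor (Y : Bᵒᵖ ⥤ Type u) (X : B ⥤ Type u) : Type u :=
  Quot (TensorRel Y X)

/-- The element `y ⊗ x` of `Y ⊗ X`. -/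
def Tensor.mk {Y : Bᵒᵖ ⥤ Type u} {X : B ⥤ Type u} {b : B} (y : Y.obj (op b)) (x : X.obj b) :
    Tensor Y X :=
  Quot.mk _ ⟨⟨b, y⟩, x⟩

theorem Tensor.mk_map {Y : Bᵒᵖ ⥤ Type u} {X : B ⥤ Type u} {b' b : B} (g : b' ⟶ b)
    (y : Y.obj (op b)) (x : X.obj b') :
    (Tensor.mk (Y.map g.op y) x : Tensor Y X) = Tensor.mk y (X.map g x) :=
  Quot.sound (TensorRel.mk g y x)

/-- The map `φ ⊗ α : Y ⊗ X → Y' ⊗ X'`, sending `y ⊗ x` to `φ(y) ⊗ α(x)`. -/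
def Tensor.map {Y Y' : Bᵒᵖ ⥤ Type u} {X X' : B ⥤ Type u} (φ : Y ⟶ Y') (α : X ⟶ X') :
    Tensor Y X → Tensor Y' X' :=
  Quot.lift (fun q => Tensor.mk (φ.app (op q.1.1) q.1.2) (α.app q.1.1 q.2)) (by
    rintro _ _ ⟨g, y, x⟩
    dsimp only
    rw [NatTrans.naturality_apply, NatTrans.naturality_apply, Tensor.mk_map])

/-- For a set-valued functor `X` on `B`, the functor `- ⊗ X` from presheaves on `B` to sets. -/
def tensorFunctor (X : B ⥤ Type u) : (Bᵒᵖ ⥤ Type u) ⥤ Type u where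
  obj Y := Tensor Y X
  map φ := ↾(Tensor.map φ (𝟙 X))
  map_id Y := by
    ext q
    induction q using Quot.ind
    rfl
  map_comp φ ψ := by
    ext q
    induction q using Quot.ind
    rfl

end Tensor

section Nondegenerate

variable {A : Type u} [SmallCategory A]

/-- A set-valued functor `X` is nondegenerate (or componentwise flat) if `- ⊗ X` preserves finite
connected limits. -/
def Nondegenerate (X : A ⥤ Type u) : Prop :=
  ∀ (J : Type) [SmallCategory J] [FinCategory J] [IsConnected J],
    PreservesLimitsOfShape J (tensorFunctor X)

/-- A functor `X` to topological spaces is nondegenerate if its underlying set-valued functor is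
nondegenerate and every map `X f` is closed. -/
def NondegenerateTop (X : A ⥤ TopCat.{u}) : Prop :=
  Nondegenerate (X ⋙ forget TopCat.{u}) ∧
    ∀ ⦃a a' : A⦄ (f : a ⟶ a'), IsClosedMap (X.map f)

/-- A presheaf is finite if its category of elements is a finite category: it has finitely many
objects and finitely many morphisms. (Mathlib's category of elements of a presheaf is the opposite
of the usual one, which does not matter here.) -/
def FinitePresheaf (Y : Aᵒᵖ ⥤ Type u) : Prop :=
  Finite Y.Elements ∧ ∀ p q : Y.Elements, Finite (p ⟶ q)

end Nondegenerate

section TensorTop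

variable {B : Type u} [SmallCategory B]

/-- The set `X(b)` underlying the space `X(b)` carries the topology of that space. -/
instance forgetTopology (X : B ⥤ TopCat.{u}) (b : B) :
    TopologicalSpace ((X ⋙ forget TopCat.{u}).obj b) :=
  (X.obj b).str

/-- For a presheaf `Y` of sets and a functor `X` to topological spaces, the quotient topology on the
set `Y ⊗ X` from the topological disjoint union of one copy of `X(b)` for each `b` and each
`y ∈ Y(b)`. -/
instance tensorTopology (Y : Bᵒᵖ ⥤ Type u) (X : B ⥤ TopCat.{u}) :
    TopologicalSpace (Tensor Y (X ⋙ forget TopCat.{u})) :=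
  inferInstanceAs (TopologicalSpace (Quot (TensorRel Y (X ⋙ forget TopCat.{u}))))

/-- The tensor product `Y ⊗ X` of a presheaf `Y` of sets and a functor `X` to topological
spaces. -/
def tensorTop (Y : Bᵒᵖ ⥤ Type u) (X : B ⥤ TopCat.{u}) : TopCat.{u} :=
  TopCat.of (Tensor Y (X ⋙ forget TopCat.{u}))

/-- The continuous map `φ ⊗ α : Y ⊗ X → Y' ⊗ X'`. -/
def tensorTopMap {Y Y' : Bᵒᵖ ⥤ Type u} {X X' : B ⥤ TopCat.{u}} (φ : Y ⟶ Y') (α : X ⟶ X') :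
    tensorTop Y X ⟶ tensorTop Y' X' :=
  TopCat.ofHom
    { toFun := Tensor.map φ (Functor.whiskerRight α (forget TopCat.{u}))
      continuous_toFun := by
        refine continuous_coinduced_dom.2 (continuous_sigma fun p => ?_)
        exact continuous_coinduced_rng.comp
          ((continuous_sigmaMk
            (σ := fun p : (Σ b : B, Y'.obj (op b)) => (X' ⋙ forget TopCat.{u}).obj p.1)
            (i := ⟨p.1, φ.app (op p.1) p.2⟩)).comp (α.app p.1).hom.continuous) }

theorem tensorTopMap_id (Y : Bᵒᵖ ⥤ Type u) (X : B ⥤ TopCat.{u}) :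
    tensorTopMap (𝟙 Y) (𝟙 X) = 𝟙 (tensorTop Y X) := by
  ext q
  induction q using Quot.ind
  rfl

theorem tensorTopMap_comp {Y Y' Y'' : Bᵒᵖ ⥤ Type u} {X X' X'' : B ⥤ TopCat.{u}}
    (φ : Y ⟶ Y') (φ' : Y' ⟶ Y'') (α : X ⟶ X') (α' : X' ⟶ X'') :
    tensorTopMap (φ ≫ φ') (α ≫ α') = tensorTopMap φ α ≫ tensorTopMap φ' α' := by
  ext q
  induction q using Quot.ind
  rfl

variable {A : Type u} [SmallCategory A]

/-- The functor `M ⊗ -` from `[B, Top]` to `[A, Top]` induced by a module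
`M : Bᵒᵖ × A → Set`, given in curried form, so that `M.obj a` is the presheaf `M(-, a)`:
`(M ⊗ X)(a) = M(-, a) ⊗ X`. -/
def moduleTensor (M : Profunctor.{u} A B) : (B ⥤ TopCat.{u}) ⥤ (A ⥤ TopCat.{u}) where
  obj X :=
    { obj := fun a => tensorTop (M.obj a) X
      map := fun f => tensorTopMap (M.map f) (𝟙 X)
      map_id := fun a => by rw [M.map_id, tensorTopMap_id]
      map_comp := fun f g => by rw [M.map_comp, ← tensorTopMap_comp, Category.comp_id] }
  map α :=
    { app := fun a => tensorTopMap (𝟙 (M.obj a)) α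
      naturality := fun a a' f => by
        rw [← tensorTopMap_comp, ← tensorTopMap_comp]
        simp only [Category.comp_id, Category.id_comp] }
  map_id X := by
    ext1
    ext1 a
    exact tensorTopMap_id _ _
  map_comp α β := by
    ext1
    ext1 a
    exact tensorTopMap_comp (𝟙 _) (𝟙 _) α β

end TensorTop

/-- An equational system: a small category `A` together with a finite nondegenerate module
`M : Aᵒᵖ × A → Set`. Here `M.obj a` is the presheaf `M(-, a)` and `M.flip.obj (op b)` is the
functor `M(b, -)`. -/
structure EquationalSystem where
  /-- the objects of the small category -/
  A : Type u
  [category : SmallCategory A]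
  /-- the module -/
  M : Profunctor.{u} A A
  finite : ∀ a : A, FinitePresheaf (M.obj a)
  nondegenerate : ∀ b : A, Nondegenerate (M.flip.obj (op b))

attribute [instance] EquationalSystem.category

/-- The category of `M`-coalgebras in `Top`: nondegenerate functors `X : A ⥤ Top` together with a
natural transformation `X ⟶ M ⊗ X`. The nondegenerate functors form a full subcategory of
`[A, Top]`, so that coalgebras for the restriction of `M ⊗ -` to them, and the maps between these,
are the same as coalgebras for `M ⊗ -` on `[A, Top]` whose underlying functor is nondegenerate,
and the maps between those. -/
abbrev EquationalSystem.CoalgTop (E : EquationalSystem.{u}) :=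
  ObjectProperty.FullSubcategory
    (fun X : Endofunctor.Coalgebra (moduleTensor E.M) => NondegenerateTop X.V)

/-- A universal solution of an equational system in `Top` is a terminal object of the category of
coalgebras in `Top`. -/
def EquationalSystem.IsUniversalSolution (E : EquationalSystem.{u}) (I : E.CoalgTop) : Prop :=
  Nonempty (IsTerminal I)

/-- A topological space `S` is realizable if it is homeomorphic to some component `I(a)` of the
universal solution of some equational system. -/
def Realizable (S : Type u) [TopologicalSpace S] : Prop :=
  ∃ (E : EquationalSystem.{u}) (I : E.CoalgTop),
    E.IsUniversalSolution I ∧ ∃ a : E.A, Nonempty (S ≃ₜ I.obj.V.obj a)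

end SelfSimilarity

/-!
# Realizable spaces are the compact metrizable spaces

Nondegeneracy of a functor `X` is used in elementwise form (`ComponentwiseFlat`): two elements of
`X` with the same image have a common refinement, and two maps that agree on an element agree on a
refinement of it. It makes equality in a tensor product `Y ⊗ X` explicit
(`Tensor.exists_of_mk_eq`): `y ⊗ x = y' ⊗ x'` only if both come from one refinement.

For a coalgebra `X` this has two consequences. Elements with a common refinement unfold to elements
with a common refinement (`Unfolds.exists_span`). And, the maps of `X` being closed and the module
finite, the elements of `X(a)` that can be unfolded `k` times along a given sequence of elements of
the module form a closed set, one of finitely many that cover `X(a)`; so the relation `Near k`, of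
belonging to a common such set, holds near the diagonal (`eventually_near`). Consequently a map of
coalgebras of sets is automatically continuous if its codomain is *shrinking*, that is, if elements
near to high order are topologically close (`Shrinking.continuous`).

*Compact metrizable spaces are realizable.* A compact metric space `S` is covered by finite families
of closed cells of every level, each cell being a union of cells of the next level and the diameters
tending to zero, with every family closed under nonempty intersections. The cells form a poset `A`,
level by level; `M(b, a)` is a point if `b` is a cell of the next level inside `a`, and is empty
otherwise. Inclusion into `S` gives a shrinking coalgebra with component `S` at the cell `S` of
level zero. An element `x` of any coalgebra unfolds along a decreasing sequence of cells, whose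
diameters tend to zero. Two such sequences for `x` have the same limit, as their cells of each level
have a common subcell, and `x ↦` limit is the only map to the coalgebra of cells.

*Realizable spaces are compact and metrizable.* Let `I` be terminal. A chain `⋯, m₂, m₁` of elements
of the module ending at `a` gives a discrete coalgebra `∑ₙ A(aₙ, -)`, and maps from it to `I` are
sequences of elements of `I` unfolding along the chain. By terminality every chain thus has exactly
one point in `I(a)`, and every element of `I(a)` is the point of a chain. The space of chains is
compact, being closed in a product of finite sets. Two chains have the same point if and only if
they are spanned by a third, and Kőnig's lemma shows that this relation is closed
(`isClosed_setOf_chainPoint_eq`). So the quotient topology on `I(a)` is compact and Hausdorff; it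
makes `I` into another coalgebra, which is shrinking and therefore second countable. The identity is
continuous from this coalgebra to `I` by terminality, and from `I` to it by
`Shrinking.continuous`, so the two topologies coincide.
-/

namespace SelfSimilarity

/-! ### Componentwise flat functors -/

section Flat

variable {B : Type u} [SmallCategory B]

/-- The elementwise form of nondegeneracy: every connected component of the category of elements
of `X` is cofiltered. -/
structure ComponentwiseFlat (X : B ⥤ Type u) : Prop where
  /-- cospans in the category of elements can be completed to commutative squares -/
  exists_span : ∀ ⦃a a' b : B⦄ (f : a ⟶ b) (f' : a' ⟶ b) (x : X.obj a) (x' : X.obj a'),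
    X.map f x = X.map f' x' → ∃ (c : B) (g : c ⟶ a) (g' : c ⟶ a') (z : X.obj c),
      g ≫ f = g' ≫ f' ∧ X.map g z = x ∧ X.map g' z = x'
  /-- parallel morphisms in the category of elements are equalized by some morphism -/
  exists_eq : ∀ ⦃a b : B⦄ (f f' : a ⟶ b) (x : X.obj a), X.map f x = X.map f' x →
    ∃ (c : B) (g : c ⟶ a) (z : X.obj c), g ≫ f = g ≫ f' ∧ X.map g z = x

variable {X : B ⥤ Type u} {Y : Bᵒᵖ ⥤ Type u}

theorem Tensor.exists_rep (t : Tensor Y X) :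
    ∃ (b : B) (y : Y.obj (op b)) (x : X.obj b), t = Tensor.mk y x := by
  induction t using Quot.ind with
  | mk q => exact ⟨_, _, _, rfl⟩

theorem tensorFunctor_map_mk {Y' : Bᵒᵖ ⥤ Type u} (φ : Y ⟶ Y') {b : B} (y : Y.obj (op b))
    (x : X.obj b) :
    (tensorFunctor X).map φ (Tensor.mk y x : Tensor Y X) =
      (Tensor.mk (φ.app (op b) y) x : Tensor Y' X) :=
  rfl

/-- For a componentwise flat functor `X`, elements of `Y ⊗ X` are equal only if they have a common
refinement: the equivalence relation in the definition of `Y ⊗ X` is generated in one step. -/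
theorem Tensor.exists_of_mk_eq (hX : ComponentwiseFlat X) {b b' : B} {y : Y.obj (op b)}
    {y' : Y.obj (op b')} {x : X.obj b} {x' : X.obj b'}
    (h : (Tensor.mk y x : Tensor Y X) = Tensor.mk y' x') :
    ∃ (c : B) (g : c ⟶ b) (g' : c ⟶ b') (z : X.obj c),
      X.map g z = x ∧ X.map g' z = x' ∧ Y.map g.op y = Y.map g'.op y' := by
  let R : (Σ p : (Σ b : B, Y.obj (op b)), X.obj p.1) →
      (Σ p : (Σ b : B, Y.obj (op b)), X.obj p.1) → Prop := fun q q' =>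
    ∃ (c : B) (g : c ⟶ q.1.1) (g' : c ⟶ q'.1.1) (z : X.obj c),
      X.map g z = q.2 ∧ X.map g' z = q'.2 ∧ Y.map g.op q.1.2 = Y.map g'.op q'.1.2
  suffices H : ∀ q q', Relation.EqvGen (TensorRel Y X) q q' → R q q' from
    H ⟨⟨b, y⟩, x⟩ ⟨⟨b', y'⟩, x'⟩ (Quot.eqvGen_exact h)
  intro q q' hq
  induction hq with
  | rel _ _ h =>
    obtain ⟨g, y, x⟩ := h
    exact ⟨_, 𝟙 _, g, x, by simp, rfl, by simp⟩
  | refl q => exact ⟨_, 𝟙 _, 𝟙 _, q.2, by simp, by simp, rfl⟩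
  | symm _ _ _ ih =>
    obtain ⟨c, g, g', z, h1, h2, h3⟩ := ih
    exact ⟨c, g', g, z, h2, h1, h3.symm⟩
  | trans _ _ _ _ _ ih ih' =>
    obtain ⟨c, g, g', z, h1, h2, h3⟩ := ih
    obtain ⟨d, k, k', w, h4, h5, h6⟩ := ih'
    obtain ⟨e, l, l', v, h7, h8, h9⟩ := hX.exists_span g' k z w (h2.trans h4.symm)
    refine ⟨e, l ≫ g, l' ≫ k', v, ?_, ?_, ?_⟩
    · rw [X.map_comp, comp_apply, h8, h1]
    · rw [X.map_comp, comp_apply, h9, h5]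
    · rw [op_comp, op_comp, Y.map_comp, Y.map_comp, comp_apply, comp_apply, h3, ← h6,
        ← comp_apply, ← comp_apply, ← Y.map_comp, ← Y.map_comp, ← op_comp, ← op_comp, h7]

/-- The map `B(-, b) ⊗ X → X(b)`, which is in fact bijective. -/
def Tensor.yonedaEval (X : B ⥤ Type u) (b : B) : Tensor (yoneda.obj b) X → X.obj b :=
  Quot.lift (fun q => X.map q.1.2 q.2) (by
    rintro _ _ ⟨g, y, x⟩
    simp)

/-- The two conditions come from the preservation of pullbacks and equalizers of representable
presheaves. -/
theorem Nondegenerate.componentwiseFlat (hX : Nondegenerate X) : ComponentwiseFlat X where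
  exists_span a a' b f f' x x' h := by
    have := hX WalkingCospan
    have sq := (IsPullback.of_hasPullback (yoneda.map f) (yoneda.map f')).map (tensorFunctor X)
    obtain ⟨t, h1, h2⟩ := Types.exists_of_isPullback sq
      (Tensor.mk (𝟙 a) x : Tensor (yoneda.obj a) X) (Tensor.mk (𝟙 a') x') (by
        change (Tensor.mk (𝟙 a ≫ f) x : Tensor (yoneda.obj b) X) = Tensor.mk (𝟙 a' ≫ f') x'
        have e1 := Tensor.mk_map (Y := yoneda.obj b) f (𝟙 b) x
        have e2 := Tensor.mk_map (Y := yoneda.obj b) f' (𝟙 b) x'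
        simp only [yoneda_obj_map, Quiver.Hom.unop_op, Category.comp_id, Category.id_comp,
          TypeCat.hom_ofHom, TypeCat.Fun.coe_mk] at e1 e2 ⊢
        refine e1.trans (Eq.trans ?_ e2.symm)
        rw [h])
    obtain ⟨c, y, z, rfl⟩ := Tensor.exists_rep t
    refine ⟨c, (pullback.fst (yoneda.map f) (yoneda.map f')).app (op c) y,
      (pullback.snd (yoneda.map f) (yoneda.map f')).app (op c) y, z, ?_, ?_, ?_⟩
    · exact ConcreteCategory.congr_hom (NatTrans.congr_app
        (pullback.condition (f := yoneda.map f) (g := yoneda.map f')) (op c)) y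
    · exact (congrArg (Tensor.yonedaEval X a) h1).trans
        (ConcreteCategory.congr_hom (X.map_id a) x)
    · exact (congrArg (Tensor.yonedaEval X a') h2).trans
        (ConcreteCategory.congr_hom (X.map_id a') x')
  exists_eq a b f f' x h := by
    have := hX WalkingParallelPair
    have hl := isLimitForkMapOfIsLimit (tensorFunctor X)
      (equalizer.condition (yoneda.map f) (yoneda.map f')) (equalizerIsEqualizer _ _)
    have hx : (tensorFunctor X).map (yoneda.map f) (Tensor.mk (𝟙 a) x : Tensor (yoneda.obj a) X)
        = (tensorFunctor X).map (yoneda.map f') (Tensor.mk (𝟙 a) x : Tensor (yoneda.obj a) X) := by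
      change (Tensor.mk (𝟙 a ≫ f) x : Tensor (yoneda.obj b) X) = Tensor.mk (𝟙 a ≫ f') x
      have e1 := Tensor.mk_map (Y := yoneda.obj b) f (𝟙 b) x
      have e2 := Tensor.mk_map (Y := yoneda.obj b) f' (𝟙 b) x
      simp only [yoneda_obj_map, Quiver.Hom.unop_op, Category.comp_id, Category.id_comp,
        TypeCat.hom_ofHom, TypeCat.Fun.coe_mk] at e1 e2 ⊢
      refine e1.trans (Eq.trans ?_ e2.symm)
      rw [h]
    obtain ⟨t, ht, -⟩ := Types.unique_of_type_equalizer _ _ hl _ hx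
    obtain ⟨c, y, z, rfl⟩ := Tensor.exists_rep t
    refine ⟨c, (equalizer.ι (yoneda.map f) (yoneda.map f')).app (op c) y, z, ?_, ?_⟩
    · exact ConcreteCategory.congr_hom (NatTrans.congr_app
        (equalizer.condition (yoneda.map f) (yoneda.map f')) (op c)) y
    · exact (congrArg (Tensor.yonedaEval X a) ht).trans
        (ConcreteCategory.congr_hom (X.map_id a) x)

/-- For elements `r` and `s` of `X` lying over `x`, the element `s` lies over `r` by a map
compatible with those to `x`. -/
def RefinesOver {b : B} (x : X.obj b)
    (r s : Σ c : B, {p : (c ⟶ b) × X.obj c // X.map p.1 p.2 = x}) : Prop :=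
  ∃ h : s.1 ⟶ r.1, h ≫ r.2.1.1 = s.2.1.1 ∧ X.map h s.2.1.2 = r.2.1.2

theorem RefinesOver.trans {b : B} {x : X.obj b}
    {r s t : Σ c : B, {p : (c ⟶ b) × X.obj c // X.map p.1 p.2 = x}} (h : RefinesOver x r s)
    (h' : RefinesOver x s t) : RefinesOver x r t := by
  obtain ⟨k, h1, h2⟩ := h
  obtain ⟨k', h3, h4⟩ := h'
  exact ⟨k' ≫ k, by rw [Category.assoc, h1, h3], by rw [X.map_comp, comp_apply, h4, h2]⟩

/-- Finitely many elements over a given element `x` have a common refinement over `x`. -/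
theorem ComponentwiseFlat.exists_common_refinement (hX : ComponentwiseFlat X) {b : B}
    (x : X.obj b) {ι : Type*} [Finite ι] {c : ι → B} (g : ∀ i, c i ⟶ b) (z : ∀ i, X.obj (c i))
    (hz : ∀ i, X.map (g i) (z i) = x) :
    ∃ (d : B) (k : d ⟶ b) (w : X.obj d) (l : ∀ i, d ⟶ c i), X.map k w = x ∧
      (∀ i, l i ≫ g i = k) ∧ ∀ i, X.map (l i) w = z i := by
  let T := Σ c : B, {p : (c ⟶ b) × X.obj c // X.map p.1 p.2 = x}
  have : IsTrans T (RefinesOver x) := ⟨fun _ _ _ => RefinesOver.trans⟩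
  have : Nonempty T := ⟨⟨b, (𝟙 b, x), by simp⟩⟩
  have hd : Directed (RefinesOver x) (id : T → T) := by
    rintro ⟨c, ⟨p, y⟩, hp⟩ ⟨c', ⟨p', y'⟩, hp'⟩
    dsimp only at hp hp'
    obtain ⟨d, k, k', w, h1, h2, h3⟩ := hX.exists_span p p' y y' (hp.trans hp'.symm)
    refine ⟨⟨d, (k ≫ p, w), ?_⟩, ⟨k, rfl, h2⟩, ⟨k', h1.symm, h3⟩⟩
    dsimp only
    rw [X.map_comp, comp_apply, h2, hp]
  obtain ⟨t, ht⟩ := hd.finite_le (fun i : ι => (⟨c i, (g i, z i), hz i⟩ : T))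
  choose l hl hl' using ht
  exact ⟨t.1, t.2.1.1, t.2.1.2, l, t.2.2, hl, hl'⟩

/-- Elements `y ⊗ x` and `y' ⊗ x` with the same second component become equal by restricting `y` and
`y'` along a single map. -/
theorem Tensor.exists_of_mk_eq_same (hX : ComponentwiseFlat X) {b : B} {y y' : Y.obj (op b)}
    {x : X.obj b} (h : (Tensor.mk y x : Tensor Y X) = Tensor.mk y' x) :
    ∃ (c : B) (g : c ⟶ b) (z : X.obj c), X.map g z = x ∧ Y.map g.op y = Y.map g.op y' := by
  obtain ⟨c, g, g', z, h1, h2, h3⟩ := Tensor.exists_of_mk_eq hX h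
  obtain ⟨d, k, w, h4, h5⟩ := hX.exists_eq g g' z (h1.trans h2.symm)
  refine ⟨d, k ≫ g, w, by rw [X.map_comp, comp_apply, h5, h1], ?_⟩
  conv_rhs => rw [h4]
  rw [op_comp, op_comp, Y.map_comp, Y.map_comp, comp_apply, comp_apply, h3]

theorem Tensor.exists_forall_of_mk_eq_same (hX : ComponentwiseFlat X) {ι : Type*} [Finite ι]
    {Y : ι → Bᵒᵖ ⥤ Type u} {b : B} {y y' : ∀ i, (Y i).obj (op b)} {x : X.obj b}
    (h : ∀ i, (Tensor.mk (y i) x : Tensor (Y i) X) = Tensor.mk (y' i) x) :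
    ∃ (c : B) (g : c ⟶ b) (z : X.obj c), X.map g z = x ∧
      ∀ i, (Y i).map g.op (y i) = (Y i).map g.op (y' i) := by
  choose c g z hz he using fun i => Tensor.exists_of_mk_eq_same hX (h i)
  obtain ⟨d, k, w, l, h1, h2, -⟩ := hX.exists_common_refinement x g z hz
  refine ⟨d, k, w, h1, fun i => ?_⟩
  rw [← h2 i, op_comp, Functor.map_comp, comp_apply, comp_apply, he]

/-- A compatible family of elements of tensor products, indexed by a finite connected category, can
be written over a single element of `X`: starting from one index, a second component can be carried
along the morphisms of `J` in either direction, at the cost of refining it. -/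
theorem ComponentwiseFlat.exists_rep_of_connected (hX : ComponentwiseFlat X) {J : Type}
    [SmallCategory J] [Finite J] [IsConnected J] {K : J ⥤ Bᵒᵖ ⥤ Type u}
    (s : ∀ j, Tensor (K.obj j) X)
    (hs : ∀ ⦃j j'⦄ (f : j ⟶ j'), (tensorFunctor X).map (K.map f) (s j) = s j') :
    ∃ (b : B) (x : X.obj b) (y : ∀ j, (K.obj j).obj (op b)), ∀ j, s j = Tensor.mk (y j) x := by
  obtain ⟨j₀⟩ := (inferInstance : Nonempty J)
  obtain ⟨b, y₀, x, h₀⟩ := Tensor.exists_rep (s j₀)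
  let p : Set J := {j | ∃ (c : B) (g : c ⟶ b) (z : X.obj c) (y : (K.obj j).obj (op c)),
    X.map g z = x ∧ s j = Tensor.mk y z}
  have key : ∀ j, j ∈ p := by
    refine fun j => induct_on_objects p (j₀ := j₀) ⟨b, 𝟙 b, x, y₀, by simp, h₀⟩ ?_ j
    intro j₁ j₂ f
    constructor
    · rintro ⟨c, g, z, y, hz, hy⟩
      refine ⟨c, g, z, (K.map f).app (op c) y, hz, ?_⟩
      rw [← hs f, hy]
      rfl
    · rintro ⟨c, g, z, y, hz, hy⟩
      obtain ⟨d, w, v, hw⟩ := Tensor.exists_rep (s j₁)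
      have h := hs f
      rw [hw, hy, tensorFunctor_map_mk] at h
      obtain ⟨e, k, k', v', h1, h2, -⟩ := Tensor.exists_of_mk_eq hX h
      refine ⟨e, k' ≫ g, v', (K.obj j₁).map k.op w, ?_, ?_⟩
      · rw [X.map_comp, comp_apply, h2, hz]
      · rw [hw, Tensor.mk_map, h1]
  choose c g z y hz hy using key
  obtain ⟨d, k, w, l, -, -, h3⟩ := hX.exists_common_refinement x g z hz
  exact ⟨d, w, fun j => (K.obj j).map (l j).op (y j), fun j => by rw [hy, Tensor.mk_map, h3]⟩

/-- The comparison map from the tensor product with a limit to the limit of tensor products is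
injective and surjective because finitely many refinements over one element of `X` can be replaced
by a single one. -/
theorem ComponentwiseFlat.nondegenerate (hX : ComponentwiseFlat X) : Nondegenerate X := by
  intro J _ _ _
  refine ⟨fun {K} => ⟨fun {c} hc => ?_⟩⟩
  have hpt : ∀ (b : B) (s : ∀ j, (K.obj j).obj (op b)),
      (∀ ⦃j j'⦄ (f : j ⟶ j'), (K.map f).app (op b) (s j) = s j') →
      ∃! y : c.pt.obj (op b), ∀ j, (c.π.app j).app (op b) y = s j := fun b s hs =>
    (Types.isLimit_iff _).1 ⟨isLimitOfPreserves ((evaluation _ _).obj (op b)) hc⟩ s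
      (fun {_ _} f => hs f)
  have hnat : ∀ (j : J) {b b' : B} (k : b' ⟶ b) (y : c.pt.obj (op b)),
      (c.π.app j).app (op b') (c.pt.map k.op y) =
        (K.obj j).map k.op ((c.π.app j).app (op b) y) := fun j _ _ k y =>
    NatTrans.naturality_apply (c.π.app j) k.op y
  have hinj : ∀ t t' : Tensor c.pt X,
      (∀ j, (tensorFunctor X).map (c.π.app j) t = (tensorFunctor X).map (c.π.app j) t') →
      t = t' := by
    intro t t' h
    obtain ⟨j₀⟩ := (inferInstance : Nonempty J)
    obtain ⟨b₁, y₁, x₁, rfl⟩ := Tensor.exists_rep t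
    obtain ⟨b₂, y₂, x₂, rfl⟩ := Tensor.exists_rep t'
    simp only [tensorFunctor_map_mk] at h
    -- Both elements are first written over a single element of `X`.
    obtain ⟨b, k₁, k₂, x, rfl, rfl, -⟩ := Tensor.exists_of_mk_eq hX (h j₀)
    have h' : ∀ j, (Tensor.mk ((c.π.app j).app (op b) (c.pt.map k₁.op y₁)) x :
        Tensor (K.obj j) X) = Tensor.mk ((c.π.app j).app (op b) (c.pt.map k₂.op y₂)) x := by
      intro j
      rw [hnat, hnat, Tensor.mk_map, Tensor.mk_map]
      exact h j
    rw [← Tensor.mk_map, ← Tensor.mk_map]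
    obtain ⟨d, k, w, rfl, hk⟩ := Tensor.exists_forall_of_mk_eq_same hX h'
    rw [← Tensor.mk_map, ← Tensor.mk_map]
    congr 1
    refine (hpt d (fun j => (c.π.app j).app (op d) (c.pt.map k.op (c.pt.map k₁.op y₁))) ?_).unique
      (fun j => rfl) fun j => ?_
    · intro j j' f
      rw [← c.w f]
      rfl
    · have := hk j
      dsimp only at this
      rw [hnat j k, hnat j k]
      exact this.symm
  rw [Types.isLimit_iff]
  intro s hs
  obtain ⟨b, x, y, hy⟩ := hX.exists_rep_of_connected s (fun _ _ f => hs f)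
  -- The chosen components need only be compatible after restriction along a single map.
  obtain ⟨d, k, w, hw, hk⟩ := Tensor.exists_forall_of_mk_eq_same hX
    (ι := Σ j : J, Σ j' : J, (j ⟶ j')) (Y := fun i => K.obj i.2.1)
    (y := fun i => (K.map i.2.2).app (op b) (y i.1)) (y' := fun i => y i.2.1) (x := x) (by
      rintro ⟨j, j', f⟩
      have h := hs f
      rw [hy, hy] at h
      exact h)
  obtain ⟨v, hv, -⟩ := hpt d (fun j => (K.obj j).map k.op (y j)) (fun j j' f => by
    rw [← hk ⟨j, j', f⟩, NatTrans.naturality_apply])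
  have hv' : ∀ j, ((tensorFunctor X).mapCone c).π.app j (Tensor.mk v w : Tensor c.pt X) = s j := by
    intro j
    rw [hy, ← hw, ← Tensor.mk_map, ← hv j]
    rfl
  exact ⟨Tensor.mk v w, hv', fun t ht => hinj _ _ fun j => (ht j).trans (hv' j).symm⟩

end Flat

/-! ### Coalgebras and their unfoldings -/

section Unfolding

open Topology

variable {A : Type u} [SmallCategory A]

/-- In `Y ⊗ X`, for `Y` finite and `X` nondegenerate, the elements `y ⊗ z` with `z` in a closed set
form a closed set: their preimage in a summand is a finite union of images, under the closed maps
`X g`, of preimages of the given closed set. -/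
theorem isClosed_setOf_mk {Y : Aᵒᵖ ⥤ Type u} {X : A ⥤ TopCat.{u}} (hY : FinitePresheaf Y)
    (hX : NondegenerateTop X) {b : A} (y : Y.obj (op b)) {Z : Set (X.obj b)} (hZ : IsClosed Z) :
    IsClosed {t : Tensor Y (X ⋙ forget TopCat.{u}) | ∃ z ∈ Z, t = Tensor.mk y z} := by
  have := hY.1
  have := hY.2
  refine isClosed_coinduced.2 (isClosed_sigma_iff.2 ?_)
  rintro ⟨c, y'⟩
  let ι := Σ e : Y.Elements, (Y.elementsMk (op c) y' ⟶ e) × (Y.elementsMk (op b) y ⟶ e)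
  have key : IsClosed (⋃ i : ι, X.map i.2.1.1.unop '' (X.map i.2.2.1.unop ⁻¹' Z)) :=
    isClosed_iUnion_of_finite fun i =>
      hX.2 _ _ (hZ.preimage (X.map i.2.2.1.unop).hom.continuous)
  refine cast (congrArg IsClosed (Set.ext fun w => ?_)) key
  rw [Set.mem_iUnion]
  refine Iff.symm (Iff.intro ?_ ?_)
  · rintro ⟨z, hz, h⟩
    obtain ⟨d, g, g', v, h1, h2, h3⟩ := Tensor.exists_of_mk_eq hX.1.componentwiseFlat h
    refine ⟨⟨⟨op d, Y.map g.op y'⟩, ⟨g.op, rfl⟩, ⟨g'.op, h3.symm⟩⟩, v, ?_, h1⟩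
    change X.map g' v ∈ Z
    rw [show X.map g' v = z from h2]
    exact hz
  · rintro ⟨⟨e, g, g'⟩, v, hv, rfl⟩
    refine ⟨_, hv, ?_⟩
    have h1 := Tensor.mk_map (X := X ⋙ forget TopCat.{u}) g.1.unop y' v
    have h2 := Tensor.mk_map (X := X ⋙ forget TopCat.{u}) g'.1.unop y v
    refine h1.symm.trans (Eq.trans ?_ h2)
    congr 1
    exact g.2.trans g'.2.symm

variable {M : Profunctor.{u} A A} {C D : Endofunctor.Coalgebra (moduleTensor M)}

/-- The element `x` of a coalgebra unfolds to `m ⊗ y`, that is, `ξ(x) = m ⊗ y`. -/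
def Unfolds (C : Endofunctor.Coalgebra (moduleTensor M)) {a b : A} (m : (M.obj a).obj (op b))
    (x : C.V.obj a) (y : C.V.obj b) : Prop :=
  C.str.app a x = (Tensor.mk m y : Tensor (M.obj a) (C.V ⋙ forget TopCat.{u}))

theorem exists_unfolds {a : A} (x : C.V.obj a) :
    ∃ (b : A) (m : (M.obj a).obj (op b)) (y : C.V.obj b), Unfolds C m x y :=
  Tensor.exists_rep (X := C.V ⋙ forget TopCat.{u}) (Y := M.obj a) (C.str.app a x)

theorem Unfolds.map {a a' b : A} {m : (M.obj a).obj (op b)} {x : C.V.obj a} {y : C.V.obj b}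
    (h : Unfolds C m x y) (f : a ⟶ a') : Unfolds C ((M.map f).app (op b) m) (C.V.map f x) y := by
  have h1 := ConcreteCategory.congr_hom (C.str.naturality f) x
  refine h1.trans ?_
  rw [comp_apply, h]
  rfl

theorem unfolds_map_iff {a b b' : A} {m : (M.obj a).obj (op b)} {x : C.V.obj a} (g : b' ⟶ b)
    {y : C.V.obj b'} : Unfolds C ((M.obj a).map g.op m) x y ↔ Unfolds C m x (C.V.map g y) := by
  unfold Unfolds
  have h := Tensor.mk_map (X := C.V ⋙ forget TopCat.{u}) g m y
  rw [h]
  rfl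

theorem Unfolds.hom {a b : A} {m : (M.obj a).obj (op b)} {x : C.V.obj a} {y : C.V.obj b}
    (h : Unfolds C m x y) (α : C ⟶ D) : Unfolds D m (α.f.app a x) (α.f.app b y) := by
  have h1 := ConcreteCategory.congr_hom (NatTrans.congr_app α.h a) x
  refine h1.symm.trans ?_
  rw [NatTrans.comp_app, comp_apply, h]
  rfl

theorem Unfolds.exists_of_unfolds (hC : NondegenerateTop C.V) {a b b' : A}
    {m : (M.obj a).obj (op b)} {m' : (M.obj a).obj (op b')} {x : C.V.obj a} {y : C.V.obj b}
    {y' : C.V.obj b'} (h : Unfolds C m x y) (h' : Unfolds C m' x y') :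
    ∃ (c : A) (g : c ⟶ b) (g' : c ⟶ b') (z : C.V.obj c),
      C.V.map g z = y ∧ C.V.map g' z = y' ∧ (M.obj a).map g.op m = (M.obj a).map g'.op m' :=
  Tensor.exists_of_mk_eq (X := C.V ⋙ forget TopCat.{u}) hC.1.componentwiseFlat (h.symm.trans h')

theorem isClosed_setOf_unfolds (hM : ∀ a, FinitePresheaf (M.obj a)) (hC : NondegenerateTop C.V)
    {a b : A} (m : (M.obj a).obj (op b)) {Z : Set (C.V.obj b)} (hZ : IsClosed Z) :
    IsClosed {x : C.V.obj a | ∃ z ∈ Z, Unfolds C m x z} :=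
  (isClosed_setOf_mk (hM a) hC m hZ).preimage (C.str.app a).hom.continuous

/-- If two elements have a common refinement, then so do the elements to which they unfold. -/
theorem Unfolds.exists_span (hC : NondegenerateTop C.V) {a b c a₁ b₁ : A}
    {m : (M.obj a).obj (op a₁)} {n : (M.obj b).obj (op b₁)} {f : c ⟶ a} {f' : c ⟶ b}
    {z : C.V.obj c} {x₁ : C.V.obj a₁} {y₁ : C.V.obj b₁} (hx : Unfolds C m (C.V.map f z) x₁)
    (hy : Unfolds C n (C.V.map f' z) y₁) :
    ∃ (c₁ : A) (p : (M.obj c).obj (op c₁)) (g : c₁ ⟶ a₁) (g' : c₁ ⟶ b₁) (z₁ : C.V.obj c₁),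
      Unfolds C p z z₁ ∧ (M.map f).app (op c₁) p = (M.obj a).map g.op m ∧
        (M.map f').app (op c₁) p = (M.obj b).map g'.op n ∧ C.V.map g z₁ = x₁ ∧
          C.V.map g' z₁ = y₁ := by
  obtain ⟨c₀, p₀, z₀, hz⟩ := exists_unfolds z
  obtain ⟨e, k, l, v, h1, h2, h3⟩ := (hz.map f).exists_of_unfolds hC hx
  obtain ⟨e', k', l', v', h4, h5, h6⟩ := (hz.map f').exists_of_unfolds hC hy
  obtain ⟨d, q, q', w, h7, h8, h9⟩ :=
    hC.1.componentwiseFlat.exists_span k k' v v' (h1.trans h4.symm)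
  have h8' : C.V.map q w = v := h8
  have h9' : C.V.map q' w = v' := h9
  refine ⟨d, (M.obj c).map (q ≫ k).op p₀, q ≫ l, q' ≫ l', w, ?_, ?_, ?_, ?_, ?_⟩
  · rw [unfolds_map_iff, C.V.map_comp, comp_apply, h8', h1]
    exact hz
  · rw [NatTrans.naturality_apply, op_comp, op_comp, Functor.map_comp, Functor.map_comp,
      comp_apply, comp_apply, h3]
  · rw [NatTrans.naturality_apply, h7, op_comp, op_comp, Functor.map_comp, Functor.map_comp,
      comp_apply, comp_apply, h6]
  · rw [C.V.map_comp, comp_apply, h8', h2]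
  · rw [C.V.map_comp, comp_apply, h9', h5]

/-- Two elements of a coalgebra are near to order `k` if they can be unfolded `k` times along the
same elements of the module. -/
def Near (C : Endofunctor.Coalgebra (moduleTensor M)) : ℕ → ∀ {a : A}, C.V.obj a → C.V.obj a → Prop
  | 0, _, _, _ => True
  | k + 1, a, x, x' => ∃ (b : A) (m : (M.obj a).obj (op b)) (y y' : C.V.obj b),
      Unfolds C m x y ∧ Unfolds C m x' y' ∧ Near C k y y'

/-- A coalgebra is shrinking if the elements near to a given element to high order are
topologically close to it. -/
def Shrinking (C : Endofunctor.Coalgebra (moduleTensor M)) : Prop :=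
  ∀ ⦃a : A⦄ (x : C.V.obj a), ∀ U ∈ 𝓝 x, ∃ k, ∀ x', Near C k x x' → x' ∈ U

theorem exists_finite_closed_cover_near (hM : ∀ a, FinitePresheaf (M.obj a))
    (hC : NondegenerateTop C.V) (k : ℕ) (a : A) :
    ∃ 𝒞 : Set (Set (C.V.obj a)), 𝒞.Finite ∧ (∀ F ∈ 𝒞, IsClosed F) ∧ (∀ x, ∃ F ∈ 𝒞, x ∈ F) ∧
      ∀ F ∈ 𝒞, ∀ x ∈ F, ∀ x' ∈ F, Near C k x x' := by
  induction k generalizing a with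
  | zero =>
    exact ⟨{Set.univ}, Set.finite_singleton _, by simp, by simp, fun _ _ _ _ _ _ => trivial⟩
  | succ k ih =>
    choose 𝒞 hfin hcl hcov hnear using ih
    have := (hM a).1
    refine ⟨⋃ e : (M.obj a).Elements,
      (fun F : Set (C.V.obj e.1.unop) => {x | ∃ z ∈ F, Unfolds C (b := e.1.unop) e.2 x z}) ''
        𝒞 e.1.unop, ?_, ?_, ?_, ?_⟩
    · exact Set.finite_iUnion fun e => (hfin _).image _
    · intro _ h𝒞
      obtain ⟨e, F, hF, rfl⟩ := Set.mem_iUnion.1 h𝒞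
      exact isClosed_setOf_unfolds hM hC _ (hcl _ F hF)
    · intro x
      obtain ⟨b, m, y, h⟩ := exists_unfolds x
      obtain ⟨F, hF, hy⟩ := hcov b y
      exact ⟨_, Set.mem_iUnion.2 ⟨⟨op b, m⟩, F, hF, rfl⟩, y, hy, h⟩
    · intro _ h𝒞
      obtain ⟨e, F, hF, rfl⟩ := Set.mem_iUnion.1 h𝒞
      rintro x ⟨y, hy, h⟩ x' ⟨y', hy', h'⟩
      exact ⟨_, e.2, y, y', h, h', hnear _ F hF y hy y' hy'⟩

theorem isOpen_sUnion_compl {T : Type*} [TopologicalSpace T] {𝒞 : Set (Set T)} (hfin : 𝒞.Finite)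
    (hcl : ∀ F ∈ 𝒞, IsClosed F) : IsOpen (⋃₀ 𝒞)ᶜ :=
  (Set.sUnion_eq_biUnion ▸ hfin.isClosed_biUnion hcl).isOpen_compl

/-- The complement of the members of a finite closed cover that avoid `x` is a neighbourhood of `x`
whose points lie in a common member with `x`. -/
theorem eventually_near (hM : ∀ a, FinitePresheaf (M.obj a)) (hC : NondegenerateTop C.V) (k : ℕ)
    {a : A} (x : C.V.obj a) : ∀ᶠ x' in 𝓝 x, Near C k x x' := by
  obtain ⟨𝒞, hfin, hcl, hcov, hnear⟩ := exists_finite_closed_cover_near hM hC k a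
  have ho : IsOpen (⋃₀ {F ∈ 𝒞 | x ∉ F})ᶜ :=
    isOpen_sUnion_compl (hfin.subset fun F hF => hF.1) fun F hF => hcl F hF.1
  filter_upwards [ho.mem_nhds (by rintro ⟨F, hF, hx⟩; exact hF.2 hx)] with x' hx'
  obtain ⟨F, hF, h⟩ := hcov x'
  exact hnear F hF x (by_contra fun hx => hx' ⟨F, ⟨hF, hx⟩, h⟩) x' h

theorem Near.map {α : ∀ a, C.V.obj a → D.V.obj a}
    (hα : ∀ ⦃a b : A⦄ (m : (M.obj a).obj (op b)) (x : C.V.obj a) (y : C.V.obj b),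
      Unfolds C m x y → Unfolds D m (α a x) (α b y)) {k : ℕ} {a : A} {x x' : C.V.obj a}
    (h : Near C k x x') : Near D k (α a x) (α a x') := by
  induction k generalizing a with
  | zero => trivial
  | succ k ih =>
    obtain ⟨b, m, y, y', h1, h2, h3⟩ := h
    exact ⟨b, m, _, _, hα _ _ _ h1, hα _ _ _ h2, ih h3⟩

/-- A map of coalgebras of sets whose codomain is shrinking is automatically continuous. -/
theorem Shrinking.continuous (hM : ∀ a, FinitePresheaf (M.obj a)) (hC : NondegenerateTop C.V)
    (hD : Shrinking D) {α : ∀ a, C.V.obj a → D.V.obj a}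
    (hα : ∀ ⦃a b : A⦄ (m : (M.obj a).obj (op b)) (x : C.V.obj a) (y : C.V.obj b),
      Unfolds C m x y → Unfolds D m (α a x) (α b y)) (a : A) : Continuous (α a) := by
  refine continuous_iff_continuousAt.2 fun x U hU => ?_
  obtain ⟨k, hk⟩ := hD _ U hU
  refine Filter.mem_map.2 ?_
  filter_upwards [eventually_near hM hC k x] with x' hx'
  exact hk _ (hx'.map hα)

/-- The finite closed covers by sets of elements near to each other yield a countable basis. -/
theorem Shrinking.secondCountableTopology (hM : ∀ a, FinitePresheaf (M.obj a))
    (hC : NondegenerateTop C.V) (hS : Shrinking C) (a : A) :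
    SecondCountableTopology (C.V.obj a) := by
  choose 𝒞 hfin hcl hcov hnear using fun k => exists_finite_closed_cover_near hM hC k a
  refine (TopologicalSpace.isTopologicalBasis_of_isOpen_of_nhds
    (s := ⋃ k, (fun 𝒟 : Set (Set (C.V.obj a)) => (⋃₀ 𝒟)ᶜ) '' {𝒟 | 𝒟 ⊆ 𝒞 k}) ?_ ?_
    ).secondCountableTopology (Set.countable_iUnion fun k =>
      ((hfin k).finite_subsets.image _).countable)
  · intro U hU
    obtain ⟨k, 𝒟, h𝒟, rfl⟩ := Set.mem_iUnion.1 hU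
    exact isOpen_sUnion_compl ((hfin k).subset h𝒟) fun F hF => hcl k F (h𝒟 hF)
  · intro x U hx hU
    obtain ⟨k, hk⟩ := hS x U (hU.mem_nhds hx)
    refine ⟨_, Set.mem_iUnion.2 ⟨k, {F ∈ 𝒞 k | x ∉ F}, fun F hF => hF.1, rfl⟩, ?_, ?_⟩
    · rintro ⟨F, hF, h⟩
      exact hF.2 h
    · intro x' hx'
      obtain ⟨F, hF, h⟩ := hcov k x'
      exact hk x' (hnear k F hF x (by_contra fun hx => hx' ⟨F, ⟨hF, hx⟩, h⟩) x' h)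

/-- A natural family of continuous maps that is compatible with unfoldings is a map of
coalgebras. -/
def coalgebraHomMk (α : ∀ a, C.V.obj a → D.V.obj a) (hc : ∀ a, Continuous (α a))
    (hn : ∀ ⦃a a' : A⦄ (f : a ⟶ a') (x : C.V.obj a), α a' (C.V.map f x) = D.V.map f (α a x))
    (hα : ∀ ⦃a b : A⦄ (m : (M.obj a).obj (op b)) (x : C.V.obj a) (y : C.V.obj b),
      Unfolds C m x y → Unfolds D m (α a x) (α b y)) : C ⟶ D where
  f :=
    { app := fun a => TopCat.ofHom ⟨α a, hc a⟩
      naturality := fun a a' f => by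
        ext x
        exact hn f x }
  h := by
    ext a x
    obtain ⟨b, m, y, h⟩ := exists_unfolds x
    have h1 := hα m x y h
    refine Eq.trans ?_ h1.symm
    rw [NatTrans.comp_app, comp_apply, h]
    rfl

end Unfolding

/-! ### Runs of a coalgebra -/

section Runs

variable {A : Type u} [SmallCategory A] {M : Profunctor.{u} A A}
  {C : Endofunctor.Coalgebra (moduleTensor M)}

/-- A run of a coalgebra: a sequence of elements, each unfolding to the next. -/
def IsRun (C : Endofunctor.Coalgebra (moduleTensor M)) (s : ℕ → Σ a : A, C.V.obj a) : Prop :=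
  ∀ n, ∃ m, Unfolds C m (s n).2 (s (n + 1)).2

theorem exists_run (x : Σ a : A, C.V.obj a) : ∃ s, IsRun C s ∧ s 0 = x := by
  have h : ∀ x : Σ a : A, C.V.obj a, ∃ y : Σ a : A, C.V.obj a, ∃ m, Unfolds C m x.2 y.2 := by
    intro x
    obtain ⟨b, m, y, h⟩ := exists_unfolds x.2
    exact ⟨⟨b, y⟩, m, h⟩
  choose next hnext using h
  exact ⟨fun n => next^[n] x, fun n => by
    dsimp only
    rw [Function.iterate_succ_apply']
    exact hnext _, rfl⟩

/-- Two elements of a coalgebra are spanned if they have a common refinement. -/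
def Spanned (C : Endofunctor.Coalgebra (moduleTensor M)) (x y : Σ a : A, C.V.obj a) : Prop :=
  ∃ (c : A) (f : c ⟶ x.1) (f' : c ⟶ y.1) (z : C.V.obj c), C.V.map f z = x.2 ∧ C.V.map f' z = y.2

theorem Spanned.refl (x : Σ a : A, C.V.obj a) : Spanned C x x :=
  ⟨x.1, 𝟙 _, 𝟙 _, x.2, by simp, by simp⟩

/-- The existence of a common refinement propagates along runs. -/
theorem Spanned.runs (hC : NondegenerateTop C.V) {s t : ℕ → Σ a : A, C.V.obj a} (hs : IsRun C s)
    (ht : IsRun C t) (h : Spanned C (s 0) (t 0)) (n : ℕ) : Spanned C (s n) (t n) := by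
  induction n with
  | zero => exact h
  | succ n ih =>
    obtain ⟨c, f, f', z, h1, h2⟩ := ih
    obtain ⟨m, hm⟩ := hs n
    obtain ⟨m', hm'⟩ := ht n
    rw [← h1] at hm
    rw [← h2] at hm'
    obtain ⟨c₁, -, g, g', z₁, -, -, -, h3, h4⟩ := hm.exists_span hC hm'
    exact ⟨c₁, g, g', z₁, h3, h4⟩

end Runs

/-! ### The self-similarity system of a compact metric space -/

section Cells

open Topology

/-- A sequence of finite families of closed subsets of a metric space, called cells, each cell being
a union of cells of the next family. Each family is closed under nonempty intersections. -/
structure CellStructure (S : Type u) [MetricSpace S] where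
  /-- the cells of a given level; those of positive level are required to be nonempty, but the
  whole space is a cell of level zero even if it is empty -/
  cells : ℕ → Set (Set S)
  finite : ∀ n, (cells n).Finite
  isClosed : ∀ n, ∀ V ∈ cells n, IsClosed V
  univ_mem : Set.univ ∈ cells 0
  inter_mem : ∀ n, ∀ V ∈ cells n, ∀ W ∈ cells n, (V ∩ W).Nonempty → V ∩ W ∈ cells n
  exists_subset : ∀ n, ∀ V ∈ cells n, ∀ x ∈ V, ∃ W ∈ cells (n + 1), x ∈ W ∧ W ⊆ V
  nonempty : ∀ n, ∀ V ∈ cells (n + 1), V.Nonempty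
  dist_le : ∀ n, ∀ V ∈ cells (n + 1), ∀ x ∈ V, ∀ y ∈ V, dist x y ≤ 1 / ((n : ℝ) + 1)

variable {S : Type u} [MetricSpace S]

/-- The cells of level `n + 1` are the nonempty intersections of a cell of level `n` with members
of a finite cover by small closed balls. -/
theorem exists_cellStructure [CompactSpace S] : Nonempty (CellStructure S) := by
  have hcov : ∀ n : ℕ, ∃ 𝒰 : Set (Set S), 𝒰.Finite ∧ (∀ U ∈ 𝒰, IsClosed U) ∧
      (∀ x, ∃ U ∈ 𝒰, x ∈ U) ∧ ∀ U ∈ 𝒰, ∀ x ∈ U, ∀ y ∈ U, dist x y ≤ 1 / ((n : ℝ) + 1) := by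
    intro n
    have hpos : (0 : ℝ) < 1 / ((n : ℝ) + 1) / 2 := by positivity
    obtain ⟨t, -, hfin, ht⟩ := Metric.finite_approx_of_totallyBounded
      (isCompact_univ (X := S)).totallyBounded _ hpos
    refine ⟨(fun y => Metric.closedBall y (1 / ((n : ℝ) + 1) / 2)) '' t, hfin.image _, ?_, ?_, ?_⟩
    · rintro _ ⟨y, -, rfl⟩
      exact Metric.isClosed_closedBall
    · intro x
      obtain ⟨y, hy, hx⟩ := Set.mem_iUnion₂.1 (ht (Set.mem_univ x))
      exact ⟨_, ⟨y, hy, rfl⟩, Metric.ball_subset_closedBall hx⟩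
    · rintro _ ⟨c, -, rfl⟩ x hx y hy
      have := dist_triangle_right x y c
      rw [Metric.mem_closedBall] at hx hy
      linarith
  choose 𝒰 hfin hcl hcov hdist using hcov
  let 𝓕 : ℕ → Set (Set S) := fun n => Nat.rec {Set.univ} (fun n 𝒱 =>
    {W | W.Nonempty ∧ ∃ V ∈ 𝒱, ∃ T ⊆ 𝒰 n, T.Nonempty ∧ W = V ∩ ⋂₀ T}) n
  refine ⟨{
    cells := 𝓕
    finite := ?_
    isClosed := ?_
    univ_mem := rfl
    inter_mem := ?_
    exists_subset := ?_
    nonempty := fun n V hV => hV.1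
    dist_le := ?_ }⟩
  · intro n
    induction n with
    | zero => exact Set.finite_singleton _
    | succ n ih =>
      refine ((ih.prod (hfin n).finite_subsets).image fun p => p.1 ∩ ⋂₀ p.2).subset ?_
      rintro W ⟨-, V, hV, T, hT, -, rfl⟩
      exact ⟨(V, T), ⟨hV, hT⟩, rfl⟩
  · intro n
    induction n with
    | zero =>
      rintro _ rfl
      exact isClosed_univ
    | succ n ih =>
      rintro _ ⟨-, V, hV, T, hT, -, rfl⟩
      exact (ih V hV).inter (isClosed_sInter fun U hU => hcl n U (hT hU))
  · intro n
    induction n with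
    | zero =>
      rintro _ rfl _ rfl -
      exact Set.inter_self _
    | succ n ih =>
      rintro _ ⟨-, V, hV, T, hT, hne, rfl⟩ _ ⟨-, V', hV', T', hT', -, rfl⟩ h
      refine ⟨h, V ∩ V', ih V hV V' hV' (h.mono fun x hx => ⟨hx.1.1, hx.2.1⟩), T ∪ T',
        Set.union_subset hT hT', hne.inl, ?_⟩
      rw [Set.sInter_union, Set.inter_inter_inter_comm]
  · intro n V hV x hx
    obtain ⟨U, hU, hxU⟩ := hcov n x
    refine ⟨V ∩ ⋂₀ {U}, ⟨⟨x, hx, by simpa⟩, V, hV, {U}, by simpa, by simp, rfl⟩, ⟨hx, by simpa⟩,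
      Set.inter_subset_left⟩
  · rintro n _ ⟨-, V, hV, T, hT, ⟨U, hU⟩, rfl⟩ x hx y hy
    exact hdist n U (hT hU) x (hx.2 U hU) y (hy.2 U hU)

/-- A cell together with its level. -/
@[ext]
structure Cell (F : CellStructure S) : Type u where
  /-- the level of a cell -/
  level : ℕ
  /-- the closed set underlying a cell -/
  carrier : Set S
  mem : carrier ∈ F.cells level

variable {F : CellStructure S}

/-- Cells are comparable only if they have the same level, and are then ordered by inclusion. -/
instance : Preorder (Cell F) where
  le a b := a.level = b.level ∧ a.carrier ⊆ b.carrier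
  le_refl a := ⟨rfl, subset_rfl⟩
  le_trans a b c h h' := ⟨h.1.trans h'.1, h.2.trans h'.2⟩

/-- `b` is a cell of the level following that of `a`, and is contained in `a`. -/
def Cell.IsPiece (b a : Cell F) : Prop :=
  b.level = a.level + 1 ∧ b.carrier ⊆ a.carrier

theorem Cell.IsPiece.trans {a a' b b' : Cell F} (h : Cell.IsPiece b a) (hb : b' ≤ b)
    (ha : a ≤ a') : Cell.IsPiece b' a' :=
  ⟨by rw [hb.1, h.1, ha.1], hb.2.trans (h.2.trans ha.2)⟩

theorem Cell.IsPiece.nonempty {b a : Cell F} (h : Cell.IsPiece b a) : b.carrier.Nonempty :=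
  F.nonempty a.level b.carrier (h.1 ▸ b.mem)

/-- Two cells of the same level with a common point intersect in a cell. -/
def Cell.inter (b b' : Cell F) (h : b.level = b'.level) (hne : (b.carrier ∩ b'.carrier).Nonempty) :
    Cell F :=
  ⟨b.level, b.carrier ∩ b'.carrier, F.inter_mem _ _ b.mem _ (h ▸ b'.mem) hne⟩

theorem Cell.inter_le_left (b b' : Cell F) (h : b.level = b'.level)
    (hne : (b.carrier ∩ b'.carrier).Nonempty) : Cell.inter b b' h hne ≤ b :=
  ⟨rfl, Set.inter_subset_left⟩

theorem Cell.inter_le_right (b b' : Cell F) (h : b.level = b'.level)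
    (hne : (b.carrier ∩ b'.carrier).Nonempty) : Cell.inter b b' h hne ≤ b' :=
  ⟨h, Set.inter_subset_right⟩

/-- The module with `M(b, a)` a point if `b` is a piece of `a`, and empty otherwise. -/
def cellModule (F : CellStructure S) : Profunctor.{u} (Cell F) (Cell F) where
  obj a :=
    { obj := fun b => ULift.{u} (PLift (Cell.IsPiece b.unop a))
      map := fun g => ↾fun h => ⟨⟨h.down.down.trans (leOfHom g.unop) le_rfl⟩⟩ }
  map f :=
    { app := fun b => ↾fun h => ⟨⟨h.down.down.trans le_rfl (leOfHom f)⟩⟩ }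

instance (a : Cell F) (b : (Cell F)ᵒᵖ) : Subsingleton (((cellModule F).obj a).obj b) :=
  inferInstanceAs (Subsingleton (ULift (PLift (Cell.IsPiece b.unop a))))

/-- The element of the cell module given by a piece. -/
def Cell.IsPiece.elt {b a : Cell F} (h : Cell.IsPiece b a) :
    ((cellModule F).obj a).obj (op b) :=
  ⟨⟨h⟩⟩

theorem finitePresheaf_cellModule (a : Cell F) : FinitePresheaf ((cellModule F).obj a) := by
  constructor
  · have := (F.finite (a.level + 1)).to_subtype
    refine Finite.of_injective (β := F.cells (a.level + 1)) (fun e =>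
      ⟨e.1.unop.carrier, e.2.down.down.1 ▸ e.1.unop.mem⟩) ?_
    rintro ⟨b, hb⟩ ⟨b', hb'⟩ h
    have h1 : b = b' := Opposite.unop_injective
      (Cell.ext (hb.down.down.1.trans hb'.down.down.1.symm) (congrArg Subtype.val h))
    subst h1
    exact congrArg (Sigma.mk b) (Subsingleton.elim hb hb')
  · intro p q
    have : Subsingleton (p ⟶ q) := ⟨fun f g => Subtype.ext (Quiver.Hom.unop_inj
      (Subsingleton.elim _ _))⟩
    infer_instance

theorem nondegenerate_cellModule (b : Cell F) : Nondegenerate ((cellModule F).flip.obj (op b)) := by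
  refine ComponentwiseFlat.nondegenerate ⟨?_, ?_⟩
  · intro a a' c f f' x x' _
    have hx : Cell.IsPiece b a := x.down.down
    have hx' : Cell.IsPiece b a' := x'.down.down
    have hsub : b.carrier ⊆ a.carrier ∩ a'.carrier := Set.subset_inter hx.2 hx'.2
    have hl : a.level = a'.level := by have := hx.1; have := hx'.1; omega
    exact ⟨Cell.inter a a' hl (hx.nonempty.mono hsub), homOfLE (Cell.inter_le_left ..),
      homOfLE (Cell.inter_le_right ..), ⟨⟨hx.1, hsub⟩⟩, rfl, rfl, rfl⟩
  · intro a c f f' x _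
    exact ⟨a, 𝟙 a, x, rfl, rfl⟩

/-- The equational system of a cell structure. -/
def cellSystem (F : CellStructure S) : EquationalSystem.{u} where
  A := Cell F
  M := cellModule F
  finite := finitePresheaf_cellModule
  nondegenerate := nondegenerate_cellModule

/-- The functor sending each cell to the closed set underlying it. -/
def cellFunctor (F : CellStructure S) : Cell F ⥤ TopCat.{u} where
  obj a := TopCat.of a.carrier
  map f := TopCat.ofHom ⟨Set.inclusion (leOfHom f).2, continuous_inclusion (leOfHom f).2⟩

theorem nondegenerateTop_cellFunctor [CompactSpace S] : NondegenerateTop (cellFunctor F) := by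
  refine ⟨ComponentwiseFlat.nondegenerate ⟨?_, ?_⟩, ?_⟩
  · rintro a a' c f f' ⟨x, hx⟩ ⟨x', hx'⟩ h
    have h : x = x' := congrArg Subtype.val h
    subst h
    have hl : a.level = a'.level := (leOfHom f).1.trans (leOfHom f').1.symm
    exact ⟨Cell.inter a a' hl ⟨x, hx, hx'⟩, homOfLE (Cell.inter_le_left ..),
      homOfLE (Cell.inter_le_right ..), ⟨x, hx, hx'⟩, rfl, rfl, rfl⟩
  · intro a c f f' x _
    exact ⟨a, 𝟙 a, x, rfl, rfl⟩
  · intro a a' f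
    have : CompactSpace ((cellFunctor F).obj a) :=
      isCompact_iff_compactSpace.1 (F.isClosed _ _ a.mem).isCompact
    have : T2Space ((cellFunctor F).obj a') := inferInstanceAs (T2Space a'.carrier)
    exact ((cellFunctor F).map f).hom.continuous.isClosedMap

/-- The point of `S` underlying an element of the tensor product. -/
def cellTensorPoint (Y : (Cell F)ᵒᵖ ⥤ Type u) :
    Tensor Y (cellFunctor F ⋙ forget TopCat.{u}) → S :=
  Quot.lift (fun q => (show q.1.1.carrier from q.2).1) (by
    rintro _ _ ⟨g, y, x⟩
    rfl)

/-- The element of `M ⊗ I` given by a point of a piece. -/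
def cellTensorMk {b a : Cell F} (h : Cell.IsPiece b a) (x : b.carrier) :
    Tensor ((cellModule F).obj a) (cellFunctor F ⋙ forget TopCat.{u}) :=
  Tensor.mk h.elt x

theorem cellTensorMk_eq {b b' a : Cell F} (h : Cell.IsPiece b a) (h' : Cell.IsPiece b' a) {x : S}
    (hx : x ∈ b.carrier) (hx' : x ∈ b'.carrier) :
    cellTensorMk h ⟨x, hx⟩ = cellTensorMk h' ⟨x, hx'⟩ := by
  have hl := h.1.trans h'.1.symm
  let c := Cell.inter b b' hl ⟨x, hx, hx'⟩
  have h1 := Tensor.mk_map (X := cellFunctor F ⋙ forget TopCat.{u})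
    (homOfLE (Cell.inter_le_left b b' hl ⟨x, hx, hx'⟩)) h.elt (⟨x, hx, hx'⟩ : c.carrier)
  have h2 := Tensor.mk_map (X := cellFunctor F ⋙ forget TopCat.{u})
    (homOfLE (Cell.inter_le_right b b' hl ⟨x, hx, hx'⟩)) h'.elt (⟨x, hx, hx'⟩ : c.carrier)
  exact h1.symm.trans h2

theorem exists_piece (a : Cell F) (x : a.carrier) :
    ∃ b : Cell F, Cell.IsPiece b a ∧ (x : S) ∈ b.carrier := by
  obtain ⟨W, hW, hx, hsub⟩ := F.exists_subset _ _ a.mem x x.2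
  exact ⟨⟨_, W, hW⟩, ⟨rfl, hsub⟩, hx⟩

/-- The structure map of the coalgebra of cells: a point of a cell, regarded as a point of any
piece containing it. -/
noncomputable def cellUnfold (a : Cell F) (x : a.carrier) :
    Tensor ((cellModule F).obj a) (cellFunctor F ⋙ forget TopCat.{u}) :=
  cellTensorMk (exists_piece a x).choose_spec.1 ⟨x, (exists_piece a x).choose_spec.2⟩

theorem cellUnfold_eq {b a : Cell F} (h : Cell.IsPiece b a) (x : a.carrier)
    (hx : (x : S) ∈ b.carrier) : cellUnfold a x = cellTensorMk h ⟨x, hx⟩ :=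
  cellTensorMk_eq _ _ _ _

/-- The structure map is continuous because it is so on each of the finitely many closed pieces. -/
theorem continuous_cellUnfold (a : Cell F) : Continuous (cellUnfold a) := by
  have := (finitePresheaf_cellModule a).1
  refine (locallyFinite_of_finite (fun e : ((cellModule F).obj a).Elements =>
    {x : a.carrier | (x : S) ∈ e.1.unop.carrier})).continuous ?_ ?_ ?_
  · refine Set.eq_univ_of_forall fun x => ?_
    obtain ⟨b, h, hx⟩ := exists_piece a x
    exact Set.mem_iUnion.2 ⟨⟨op b, h.elt⟩, hx⟩
  · exact fun e => (F.isClosed _ _ e.1.unop.mem).preimage continuous_subtype_val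
  · intro e
    rw [continuousOn_iff_continuous_domRestrict]
    have h : Cell.IsPiece e.1.unop a := e.2.down.down
    have hc : Continuous (cellTensorMk h) := by
      refine continuous_coinduced_rng.comp (continuous_sigmaMk
        (σ := fun p : (Σ b : Cell F, ((cellModule F).obj a).obj (op b)) =>
          (cellFunctor F ⋙ forget TopCat.{u}).obj p.1) (i := ⟨e.1.unop, h.elt⟩))
    refine (hc.comp (Continuous.subtype_mk
      (continuous_subtype_val.comp continuous_subtype_val) fun x => x.2)).congr fun x => ?_
    exact (cellUnfold_eq h x.1 x.2).symm

/-- The coalgebra of cells. -/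
noncomputable def cellCoalgebra (F : CellStructure S) :
    Endofunctor.Coalgebra (moduleTensor (cellModule F)) where
  V := cellFunctor F
  str :=
    { app := fun a => TopCat.ofHom ⟨cellUnfold a, continuous_cellUnfold a⟩
      naturality := fun a a' f => by
        ext x
        obtain ⟨b, h, hx⟩ := exists_piece a x
        have h1 := cellUnfold_eq (h.trans le_rfl (leOfHom f))
          (Set.inclusion (leOfHom f).2 x) hx
        refine h1.trans ?_
        change _ = tensorTopMap ((cellModule F).map f) (𝟙 _) (cellUnfold a x)
        rw [cellUnfold_eq h x hx]
        rfl }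

/-- The point of `S` given by an element of a cell. -/
def cellPoint {a : Cell F} (x : (cellCoalgebra F).V.obj a) : S :=
  (show a.carrier from x).1

theorem cellPoint_mem {a : Cell F} (x : (cellCoalgebra F).V.obj a) : cellPoint x ∈ a.carrier :=
  (show a.carrier from x).2

theorem cellPoint_injective {a : Cell F} {x y : (cellCoalgebra F).V.obj a}
    (h : cellPoint x = cellPoint y) : x = y :=
  Subtype.ext h

theorem unfolds_cellCoalgebra_iff {a b : Cell F} (m : ((cellModule F).obj a).obj (op b))
    (x : (cellCoalgebra F).V.obj a) (y : (cellCoalgebra F).V.obj b) :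
    Unfolds (cellCoalgebra F) m x y ↔ cellPoint x = cellPoint y := by
  constructor
  · exact fun h => congrArg (cellTensorPoint _) h
  · intro h
    have hx : cellPoint x ∈ b.carrier := h ▸ cellPoint_mem y
    refine (cellUnfold_eq m.down.down x hx).trans ?_
    exact congrArg (cellTensorMk m.down.down) (Subtype.ext h)

theorem Near.exists_cell {k : ℕ} {a : Cell F} {x y : (cellCoalgebra F).V.obj a}
    (h : Near (cellCoalgebra F) k x y) :
    ∃ V ∈ F.cells (a.level + k), cellPoint x ∈ V ∧ cellPoint y ∈ V := by
  induction k generalizing a with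
  | zero => exact ⟨a.carrier, a.mem, cellPoint_mem x, cellPoint_mem y⟩
  | succ k ih =>
    obtain ⟨b, m, x', y', h1, h2, h3⟩ := h
    obtain ⟨V, hV, hx, hy⟩ := ih h3
    rw [unfolds_cellCoalgebra_iff] at h1 h2
    have hl : b.level + k = a.level + (k + 1) := by
      have : b.level = a.level + 1 := m.down.down.1
      omega
    exact ⟨V, hl ▸ hV, h1 ▸ hx, h2 ▸ hy⟩

theorem shrinking_cellCoalgebra : Shrinking (cellCoalgebra F) := by
  intro a x U hU
  obtain ⟨W, hW, hWU⟩ := mem_nhds_induced (Subtype.val : a.carrier → S) x U |>.1 hU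
  obtain ⟨ε, hε, hball⟩ := Metric.mem_nhds_iff.1 hW
  obtain ⟨n, hn⟩ := exists_nat_one_div_lt hε
  refine ⟨n + 1, fun x' h => hWU (hball ?_)⟩
  obtain ⟨V, hV, hx, hx'⟩ := h.exists_cell
  refine Metric.mem_ball.2 (lt_of_le_of_lt (F.dist_le (a.level + n) V hV _ hx' _ hx)
    (lt_of_le_of_lt ?_ hn))
  refine one_div_le_one_div_of_le (by positivity) ?_
  push_cast
  linarith [(Nat.cast_nonneg a.level : (0 : ℝ) ≤ a.level)]

section Limits

variable {C : Endofunctor.Coalgebra (moduleTensor (cellModule F))}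

/-- The point `p` lies in all the cells occurring in some run starting at `x`. -/
def IsLimitPoint (x : Σ a : Cell F, C.V.obj a) (p : S) : Prop :=
  ∃ s, IsRun C s ∧ s 0 = x ∧ ∀ n, p ∈ (s n).1.carrier

theorem IsRun.isPiece {s : ℕ → Σ a : Cell F, C.V.obj a} (hs : IsRun C s) (n : ℕ) :
    Cell.IsPiece (s (n + 1)).1 (s n).1 := by
  obtain ⟨m, -⟩ := hs n
  exact m.down.down

theorem IsRun.level {s : ℕ → Σ a : Cell F, C.V.obj a} (hs : IsRun C s) (n : ℕ) :
    (s n).1.level = (s 0).1.level + n := by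
  induction n with
  | zero => rfl
  | succ n ih => rw [(hs.isPiece n).1, ih, add_assoc]

theorem exists_isLimitPoint [CompactSpace S] (x : Σ a : Cell F, C.V.obj a) :
    ∃ p, IsLimitPoint x p := by
  obtain ⟨s, hs, h0⟩ := exists_run x
  obtain ⟨p, hp⟩ := IsCompact.nonempty_iInter_of_sequence_nonempty_isCompact_isClosed
    (fun n => (s (n + 1)).1.carrier) (fun n => (hs.isPiece (n + 1)).2)
    (fun n => (hs.isPiece n).nonempty) (F.isClosed _ _ (s 1).1.mem).isCompact
    (fun n => F.isClosed _ _ (s (n + 1)).1.mem)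
  rw [Set.mem_iInter] at hp
  refine ⟨p, s, hs, h0, fun n => ?_⟩
  exact (hs.isPiece n).2 (hp n)

/-- Limit points of elements with a common refinement agree: corresponding cells of the two runs
both contain a smaller cell, so they meet, and their diameters tend to zero. -/
theorem IsLimitPoint.eq (hC : NondegenerateTop C.V) {x y : Σ a : Cell F, C.V.obj a} {p q : S}
    (hp : IsLimitPoint x p) (hq : IsLimitPoint y q) (h : Spanned C x y) : p = q := by
  obtain ⟨s, hs, rfl, hps⟩ := hp
  obtain ⟨t, ht, rfl, hqt⟩ := hq
  refine eq_of_forall_dist_le fun ε hε => ?_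
  obtain ⟨n, hn⟩ := exists_nat_one_div_lt (half_pos hε)
  obtain ⟨c, f, f', -⟩ := h.runs hC hs ht (n + 1)
  have hc : c.level = (s 0).1.level + n + 1 := (leOfHom f).1.trans (hs.level (n + 1))
  have hc' : c.level = (t 0).1.level + n + 1 := (leOfHom f').1.trans (ht.level (n + 1))
  have hsn : (s (n + 1)).1.carrier ∈ F.cells ((s 0).1.level + n + 1) :=
    (hs.level (n + 1) : _ = (s 0).1.level + n + 1) ▸ (s (n + 1)).1.mem
  have htn : (t (n + 1)).1.carrier ∈ F.cells ((t 0).1.level + n + 1) :=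
    (ht.level (n + 1) : _ = (t 0).1.level + n + 1) ▸ (t (n + 1)).1.mem
  obtain ⟨r, hr⟩ := F.nonempty ((s 0).1.level + n) c.carrier (hc ▸ c.mem)
  have h1 := F.dist_le _ _ hsn p (hps _) r ((leOfHom f).2 hr)
  have h2 := F.dist_le _ _ htn r ((leOfHom f').2 hr) q (hqt _)
  have key : ∀ l : ℕ, 1 / (((l + n : ℕ) : ℝ) + 1) ≤ 1 / ((n : ℝ) + 1) := fun l => by
    refine one_div_le_one_div_of_le (by positivity) ?_
    push_cast
    linarith [(Nat.cast_nonneg l : (0 : ℝ) ≤ l)]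
  linarith [dist_triangle p r q, key (s 0).1.level, key (t 0).1.level]

theorem IsLimitPoint.of_unfolds {a b : Cell F} {m : ((cellModule F).obj a).obj (op b)}
    {x : C.V.obj a} {y : C.V.obj b} (h : Unfolds C m x y) {p : S}
    (hp : IsLimitPoint (C := C) ⟨b, y⟩ p) : IsLimitPoint (C := C) ⟨a, x⟩ p := by
  obtain ⟨s, hs, h0, hps⟩ := hp
  have hm : ∃ m, Unfolds C m x (s 0).2 := by
    rw [h0]
    exact ⟨m, h⟩
  refine ⟨fun n => Nat.casesOn n ⟨a, x⟩ s, fun n => ?_, rfl, fun n => ?_⟩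
  · cases n with
    | zero => exact hm
    | succ n => exact hs n
  · cases n with
    | zero =>
      obtain ⟨m', -⟩ := hm
      exact m'.down.down.2 (hps 0)
    | succ n => exact hps n

/-- The limit of the cells occurring in any run starting at `x`. -/
noncomputable def limitPoint [CompactSpace S] {a : Cell F} (x : C.V.obj a) : S :=
  (exists_isLimitPoint (C := C) ⟨a, x⟩).choose

theorem isLimitPoint_limitPoint [CompactSpace S] {a : Cell F} (x : C.V.obj a) :
    IsLimitPoint (C := C) ⟨a, x⟩ (limitPoint x) :=
  (exists_isLimitPoint (C := C) ⟨a, x⟩).choose_spec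

theorem limitPoint_mem [CompactSpace S] {a : Cell F} (x : C.V.obj a) :
    limitPoint x ∈ a.carrier := by
  obtain ⟨s, -, h0, h⟩ := isLimitPoint_limitPoint x
  have := h 0
  rwa [h0] at this

/-- The element of the coalgebra of cells given by the limit of any run starting at `x`. -/
noncomputable def toCell [CompactSpace S] (a : Cell F) (x : C.V.obj a) :
    (cellCoalgebra F).V.obj a :=
  (⟨limitPoint x, limitPoint_mem x⟩ : a.carrier)

theorem unfolds_toCell [CompactSpace S] (hC : NondegenerateTop C.V) ⦃a b : Cell F⦄
    (m : ((cellModule F).obj a).obj (op b)) (x : C.V.obj a) (y : C.V.obj b)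
    (h : Unfolds C m x y) : Unfolds (cellCoalgebra F) m (toCell a x) (toCell b y) :=
  (unfolds_cellCoalgebra_iff ..).2 ((isLimitPoint_limitPoint x).eq hC
    ((isLimitPoint_limitPoint y).of_unfolds h) (.refl _))

/-- The map from an arbitrary coalgebra to the coalgebra of cells. -/
noncomputable def toCellHom [CompactSpace S] (hC : NondegenerateTop C.V) : C ⟶ cellCoalgebra F :=
  coalgebraHomMk toCell
    (shrinking_cellCoalgebra.continuous finitePresheaf_cellModule hC (unfolds_toCell hC))
    (fun a a' f x => cellPoint_injective ((isLimitPoint_limitPoint _).eq hC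
      (isLimitPoint_limitPoint x) ⟨a, f, 𝟙 a, x, rfl, by simp⟩))
    (unfolds_toCell hC)

theorem toCellHom_unique [CompactSpace S] (hC : NondegenerateTop C.V) (β : C ⟶ cellCoalgebra F) :
    β = toCellHom hC := by
  ext a x
  refine cellPoint_injective (IsLimitPoint.eq hC ?_ (isLimitPoint_limitPoint x) (.refl _))
  obtain ⟨s, hs, h0⟩ := exists_run (C := C) ⟨a, x⟩
  have key : ∀ n, cellPoint (β.f.app (s n).1 (s n).2) = cellPoint (β.f.app (s 0).1 (s 0).2) := by
    intro n
    induction n with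
    | zero => rfl
    | succ n ih =>
      obtain ⟨m, hm⟩ := hs n
      rw [← ih, (unfolds_cellCoalgebra_iff ..).1 (hm.hom β)]
  refine ⟨s, hs, h0, fun n => ?_⟩
  rw [h0] at key
  exact key n ▸ cellPoint_mem _

end Limits

theorem realizable_of_compact_metric (S : Type u) [MetricSpace S] [CompactSpace S] :
    Realizable S := by
  obtain ⟨F⟩ := exists_cellStructure (S := S)
  let I : (cellSystem F).CoalgTop := ⟨cellCoalgebra F, nondegenerateTop_cellFunctor⟩
  refine ⟨cellSystem F, I, ⟨IsTerminal.ofUniqueHom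
    (fun C => ObjectProperty.homMk (toCellHom C.property)) fun C β => ?_⟩,
    (⟨0, Set.univ, F.univ_mem⟩ : Cell F), ⟨(Homeomorph.Set.univ S).symm⟩⟩
  exact ObjectProperty.hom_ext _ (toCellHom_unique C.property β.hom)

end Cells

/-! ### Chains and their points in a terminal coalgebra -/

section Terminal

open Topology

variable {A : Type u} [SmallCategory A] {M : Profunctor.{u} A A}
  {C I : Endofunctor.Coalgebra (moduleTensor M)}

/-- `I` is terminal among the nondegenerate coalgebras for a finite module, and is itself
nondegenerate. -/
structure IsTerminalCoalgebra (I : Endofunctor.Coalgebra (moduleTensor M)) : Prop where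
  finite : ∀ a, FinitePresheaf (M.obj a)
  nondegenerate : NondegenerateTop I.V
  exists_hom : ∀ C : Endofunctor.Coalgebra (moduleTensor M), NondegenerateTop C.V →
    Nonempty (C ⟶ I)
  hom_unique : ∀ C : Endofunctor.Coalgebra (moduleTensor M), NondegenerateTop C.V →
    ∀ f g : C ⟶ I, f = g

/-- For a sequence of objects `aₙ`, the functor `∑ₙ A(aₙ, -)` with discrete values. -/
def chainFunctor (ob : ℕ → A) : A ⥤ TopCat.{u} :=
  { obj := fun c => Σ n, (ob n ⟶ c)
    map := fun f => ↾fun p => ⟨p.1, p.2 ≫ f⟩ : A ⥤ Type u } ⋙ TopCat.discrete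

theorem nondegenerateTop_chainFunctor (ob : ℕ → A) : NondegenerateTop (chainFunctor ob) := by
  refine ⟨ComponentwiseFlat.nondegenerate ⟨?_, ?_⟩, ?_⟩
  · rintro a a' b f f' ⟨n, g⟩ ⟨n', g'⟩ h
    have h : (⟨n, g ≫ f⟩ : Σ n, (ob n ⟶ b)) = ⟨n', g' ≫ f'⟩ := h
    obtain rfl : n = n' := congrArg Sigma.fst h
    refine ⟨ob n, g, g', (⟨n, 𝟙 _⟩ : Σ n', (ob n' ⟶ ob n)), eq_of_heq (Sigma.mk.inj h).2, ?_, ?_⟩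
    · exact congrArg (Sigma.mk n) (Category.id_comp g)
    · exact congrArg (Sigma.mk n) (Category.id_comp g')
  · rintro a b f f' ⟨n, g⟩ h
    have h : (⟨n, g ≫ f⟩ : Σ n, (ob n ⟶ b)) = ⟨n, g ≫ f'⟩ := h
    refine ⟨ob n, g, (⟨n, 𝟙 _⟩ : Σ n', (ob n' ⟶ ob n)), eq_of_heq (Sigma.mk.inj h).2, ?_⟩
    exact congrArg (Sigma.mk n) (Category.id_comp g)
  · intro a a' f Z _
    have : DiscreteTopology ((chainFunctor ob).obj a') := ⟨rfl⟩
    exact isClosed_discrete _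

/-- The coalgebra `∑ₙ A(aₙ, -)` of a chain of elements `mₙ ∈ M(aₙ₊₁, aₙ)`: the generator in degree
`n` unfolds to the tensor product of `mₙ` with the generator in degree `n + 1`. -/
def chainCoalgebra (ob : ℕ → A) (m : ∀ n, (M.obj (ob n)).obj (op (ob (n + 1)))) :
    Endofunctor.Coalgebra (moduleTensor M) where
  V := chainFunctor ob
  str :=
    { app := fun c => @TopCat.ofHom ((chainFunctor ob).obj c) _ _ _
        { toFun := fun p : Σ n, (ob n ⟶ c) =>
            (Tensor.mk ((M.map p.2).app _ (m p.1))
              (⟨p.1 + 1, 𝟙 _⟩ : Σ n, (ob n ⟶ ob (p.1 + 1))) :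
                Tensor (M.obj c) (chainFunctor ob ⋙ forget TopCat.{u}))
          continuous_toFun := by
            have : DiscreteTopology ((chainFunctor ob).obj c) := ⟨rfl⟩
            exact continuous_of_discreteTopology }
      naturality := fun c c' f => by
        ext p
        obtain ⟨n, g⟩ := p
        refine congrArg (fun y => (Tensor.mk y (⟨n + 1, 𝟙 _⟩ : Σ n', (ob n' ⟶ ob (n + 1))) :
          Tensor (M.obj c') (chainFunctor ob ⋙ forget TopCat.{u}))) ?_
        exact ConcreteCategory.congr_hom (NatTrans.congr_app (M.map_comp g f) _) (m n) }

/-- The generator in degree `n` of the coalgebra of a chain. -/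
def chainGen (ob : ℕ → A) (n : ℕ) : (chainFunctor ob).obj (ob n) :=
  (⟨n, 𝟙 _⟩ : Σ n', (ob n' ⟶ ob n))

variable {ob : ℕ → A} {m : ∀ n, (M.obj (ob n)).obj (op (ob (n + 1)))}

theorem unfolds_chainGen (n : ℕ) :
    Unfolds (chainCoalgebra ob m) (m n) (chainGen ob n) (chainGen ob (n + 1)) := by
  refine congrArg (fun y => (Tensor.mk y (chainGen ob (n + 1)) :
    Tensor (M.obj (ob n)) (chainFunctor ob ⋙ forget TopCat.{u}))) ?_
  exact ConcreteCategory.congr_hom (NatTrans.congr_app (M.map_id (ob n)) _) (m n)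

/-- A sequence of elements of a coalgebra unfolding along a chain amounts to a map from the
coalgebra of the chain. -/
def chainHom (x : ∀ n, C.V.obj (ob n)) (hx : ∀ n, Unfolds C (m n) (x n) (x (n + 1))) :
    chainCoalgebra ob m ⟶ C where
  f :=
    { app := fun c => @TopCat.ofHom ((chainFunctor ob).obj c) (C.V.obj c) _ _
        { toFun := fun p : Σ n, (ob n ⟶ c) => C.V.map p.2 (x p.1)
          continuous_toFun := by
            have : DiscreteTopology ((chainFunctor ob).obj c) := ⟨rfl⟩
            exact continuous_of_discreteTopology }
      naturality := fun c c' f => by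
        ext p
        exact ConcreteCategory.congr_hom (C.V.map_comp p.2 f) (x p.1) }
  h := by
    ext c p
    obtain ⟨n, g⟩ := p
    refine Eq.trans ?_ ((hx n).map g).symm
    refine congrArg (fun y => (Tensor.mk ((M.map g).app _ (m n)) y :
      Tensor (M.obj c) (C.V ⋙ forget TopCat.{u}))) ?_
    exact ConcreteCategory.congr_hom (C.V.map_id (ob (n + 1))) (x (n + 1))

theorem IsTerminalCoalgebra.exists_unfolds_chain (hI : IsTerminalCoalgebra I) (ob : ℕ → A)
    (m : ∀ n, (M.obj (ob n)).obj (op (ob (n + 1)))) :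
    ∃ x : ∀ n, I.V.obj (ob n), ∀ n, Unfolds I (m n) (x n) (x (n + 1)) := by
  obtain ⟨α⟩ := hI.exists_hom (chainCoalgebra ob m) (nondegenerateTop_chainFunctor ob)
  exact ⟨fun n => α.f.app (ob n) (chainGen ob n), fun n => (unfolds_chainGen n).hom α⟩

theorem IsTerminalCoalgebra.unfolds_chain_unique (hI : IsTerminalCoalgebra I)
    {x y : ∀ n, I.V.obj (ob n)} (hx : ∀ n, Unfolds I (m n) (x n) (x (n + 1)))
    (hy : ∀ n, Unfolds I (m n) (y n) (y (n + 1))) : x = y := by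
  funext n
  have h := hI.hom_unique _ (nondegenerateTop_chainFunctor ob) (chainHom x hx) (chainHom y hy)
  have h1 := ConcreteCategory.congr_hom
    (NatTrans.congr_app (congrArg Endofunctor.Coalgebra.Hom.f h) (ob n)) (chainGen ob n)
  have h2 : I.V.map (𝟙 (ob n)) (x n) = I.V.map (𝟙 (ob n)) (y n) := h1
  simpa using h2

/-- An element of the module together with its two indices. -/
structure Link (M : Profunctor.{u} A A) : Type u where
  /-- the covariant index -/
  tgt : A
  /-- the contravariant index -/
  src : A
  /-- the element of the module -/
  elt : (M.obj tgt).obj (op src)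

instance : TopologicalSpace (Link M) := ⊥

instance : DiscreteTopology (Link M) := ⟨rfl⟩

/-- The relation `Unfolds` between elements whose indices are not prescribed. -/
inductive LinkUnfolds (C : Endofunctor.Coalgebra (moduleTensor M)) :
    Link M → (Σ a : A, C.V.obj a) → (Σ a : A, C.V.obj a) → Prop
  | mk {a b : A} {m : (M.obj a).obj (op b)} {x : C.V.obj a} {y : C.V.obj b}
      (h : Unfolds C m x y) : LinkUnfolds C ⟨a, b, m⟩ ⟨a, x⟩ ⟨b, y⟩

theorem linkUnfolds_iff {a b : A} {m : (M.obj a).obj (op b)} {x : C.V.obj a} {y : C.V.obj b} :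
    LinkUnfolds C ⟨a, b, m⟩ ⟨a, x⟩ ⟨b, y⟩ ↔ Unfolds C m x y := by
  constructor
  · intro h
    cases h with
    | mk h => exact h
  · exact LinkUnfolds.mk

/-- A sequence of composable links. -/
def IsChain (s : ℕ → Link M) : Prop :=
  ∀ n, (s n).src = (s (n + 1)).tgt

theorem IsChain.exists_eq {s : ℕ → Link M} (hs : IsChain s) :
    ∃ (ob : ℕ → A) (m : ∀ n, (M.obj (ob n)).obj (op (ob (n + 1)))),
      s = fun n => ⟨ob n, ob (n + 1), m n⟩ := by
  have h : ∀ n, ∃ m : (M.obj (s n).tgt).obj (op (s (n + 1)).tgt),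
      s n = ⟨(s n).tgt, (s (n + 1)).tgt, m⟩ := by
    intro n
    rw [← hs n]
    exact ⟨(s n).elt, rfl⟩
  choose m hm using h
  exact ⟨_, m, funext hm⟩

/-- The sequence `x` of elements unfolds along the sequence `s` of links. -/
def Follows (C : Endofunctor.Coalgebra (moduleTensor M)) (s : ℕ → Link M)
    (x : ℕ → Σ a : A, C.V.obj a) : Prop :=
  ∀ n, LinkUnfolds C (s n) (x n) (x (n + 1))

theorem IsTerminalCoalgebra.exists_follows (hI : IsTerminalCoalgebra I) {s : ℕ → Link M}
    (hs : IsChain s) : ∃ x, Follows I s x := by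
  obtain ⟨ob, m, rfl⟩ := hs.exists_eq
  obtain ⟨x, hx⟩ := hI.exists_unfolds_chain ob m
  exact ⟨fun n => ⟨ob n, x n⟩, fun n => .mk (hx n)⟩

theorem IsTerminalCoalgebra.follows_unique (hI : IsTerminalCoalgebra I) {s : ℕ → Link M}
    (hs : IsChain s) {x y : ℕ → Σ a : A, I.V.obj a} (hx : Follows I s x) (hy : Follows I s y) :
    x = y := by
  obtain ⟨ob, m, rfl⟩ := hs.exists_eq
  have key : ∀ x, Follows I (fun n => ⟨ob n, ob (n + 1), m n⟩) x →
      ∃ x' : ∀ n, I.V.obj (ob n), x = fun n => ⟨ob n, x' n⟩ := by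
    intro x hx
    have h : ∀ n, ∃ x' : I.V.obj (ob n), x n = ⟨ob n, x'⟩ := by
      intro n
      have h := hx n
      generalize x n = p at h
      generalize x (n + 1) = q at h
      cases h with
      | mk h => exact ⟨_, rfl⟩
    choose x' hx' using h
    exact ⟨x', funext hx'⟩
  obtain ⟨x', rfl⟩ := key x hx
  obtain ⟨y', rfl⟩ := key y hy
  rw [hI.unfolds_chain_unique (m := m) (fun n => linkUnfolds_iff.1 (hx n))
    fun n => linkUnfolds_iff.1 (hy n)]

theorem Follows.tgt {s : ℕ → Link M} {x : ℕ → Σ a : A, C.V.obj a} (h : Follows C s x) (n : ℕ) :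
    (s n).tgt = (x n).1 := by
  have h := h n
  generalize s n = l, x n = p, x (n + 1) = q at h
  cases h
  rfl

theorem Follows.isChain {s : ℕ → Link M} {x : ℕ → Σ a : A, C.V.obj a} (h : Follows C s x) :
    IsChain s := by
  intro n
  rw [h.tgt (n + 1)]
  have h := h n
  generalize s n = l, x n = p, x (n + 1) = q at h
  cases h
  rfl

/-- The space of chains ending at `a`, with the topology of pointwise convergence. -/
def ChainAt (M : Profunctor.{u} A A) (a : A) : Type u :=
  {s : ℕ → Link M // IsChain s ∧ (s 0).tgt = a}

instance (a : A) : TopologicalSpace (ChainAt M a) := inferInstanceAs (TopologicalSpace (Subtype _))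

instance (a : A) : T2Space (ChainAt M a) := inferInstanceAs (T2Space (Subtype _))

theorem continuous_chainAt_val {a : A} :
    Continuous (Subtype.val : ChainAt M a → (ℕ → Link M)) :=
  continuous_subtype_val

theorem finite_setOf_tgt_eq (hM : ∀ a, FinitePresheaf (M.obj a)) (a : A) :
    {l : Link M | l.tgt = a}.Finite := by
  have := (hM a).1
  refine (Set.finite_range fun e : (M.obj a).Elements => (⟨a, e.1.unop, e.2⟩ : Link M)).subset ?_
  rintro ⟨a, b, m⟩ rfl
  exact ⟨(M.obj a).elementsMk (op b) m, rfl⟩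

/-- Chains ending at `a` form a closed subspace of a product of finite discrete spaces. -/
theorem compactSpace_chainAt (hM : ∀ a, FinitePresheaf (M.obj a)) (a : A) :
    CompactSpace (ChainAt M a) := by
  let R : ℕ → Set (Link M) := fun n => Nat.rec {l | l.tgt = a}
    (fun _ R => ⋃ l ∈ R, {l' | l'.tgt = l.src}) n
  have hR : ∀ n, (R n).Finite := by
    intro n
    induction n with
    | zero => exact finite_setOf_tgt_eq hM a
    | succ n ih => exact ih.biUnion fun l _ => finite_setOf_tgt_eq hM _
  have hcl : IsClosed {s : ℕ → Link M | IsChain s ∧ (s 0).tgt = a} := by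
    have h1 : IsClosed {s : ℕ → Link M | IsChain s} := by
      have : {s : ℕ → Link M | IsChain s} =
          ⋂ n, (fun s : ℕ → Link M => (s n, s (n + 1))) ⁻¹' {q | q.1.src = q.2.tgt} := by
        ext s
        rw [Set.mem_iInter]
        rfl
      rw [this]
      exact isClosed_iInter fun n => (isClosed_discrete _).preimage (by fun_prop)
    have h2 : IsClosed ((fun s : ℕ → Link M => s 0) ⁻¹' {l | l.tgt = a}) :=
      (isClosed_discrete _).preimage (continuous_apply 0)
    exact h1.inter h2
  refine isCompact_iff_compactSpace.1
    ((isCompact_univ_pi fun n => (hR n).isCompact).of_isClosed_subset hcl ?_)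
  rintro s ⟨hs, h0⟩ n -
  induction n with
  | zero => exact h0
  | succ n ih => exact Set.mem_biUnion ih (hs n).symm

/-- Extension of a chain by an element of the module. -/
def ChainAt.cons {a b : A} (m : (M.obj a).obj (op b)) (q : ChainAt M b) : ChainAt M a :=
  ⟨fun n => Nat.casesOn n ⟨a, b, m⟩ q.1, fun n => by
    cases n with
    | zero => exact q.2.2.symm
    | succ n => exact q.2.1 n, rfl⟩

theorem ChainAt.exists_cons {a : A} (p : ChainAt M a) :
    ∃ (b : A) (m : (M.obj a).obj (op b)) (q : ChainAt M b), p = ChainAt.cons m q := by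
  obtain ⟨s, hs, rfl⟩ := p
  refine ⟨(s 0).src, (s 0).elt, ⟨fun n => s (n + 1), fun n => hs (n + 1), (hs 0).symm⟩, ?_⟩
  refine Subtype.ext (funext fun n => ?_)
  cases n <;> rfl

theorem ChainAt.isOpenEmbedding_cons {a b : A} (m : (M.obj a).obj (op b)) :
    IsOpenEmbedding (ChainAt.cons m) := by
  have hc : Continuous (ChainAt.cons m) := by
    refine Continuous.subtype_mk (continuous_pi fun n => ?_) _
    cases n with
    | zero => exact continuous_const
    | succ n => exact (continuous_apply n).comp continuous_chainAt_val
  refine ⟨.of_comp hc (g := fun p : ChainAt M a => fun n => p.1 (n + 1))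
    (continuous_pi fun n => (continuous_apply (n + 1)).comp continuous_chainAt_val)
    (.subtypeVal : IsEmbedding (Subtype.val : ChainAt M b → (ℕ → Link M))), ?_⟩
  have : Set.range (ChainAt.cons m) =
      (fun p : ChainAt M a => p.1 0) ⁻¹' {(⟨a, b, m⟩ : Link M)} := by
    ext p
    constructor
    · rintro ⟨q, rfl⟩
      rfl
    · intro h
      obtain ⟨b', m', q, rfl⟩ := p.exists_cons
      have h : (⟨a, b', m'⟩ : Link M) = ⟨a, b, m⟩ := h
      cases h
      exact ⟨q, rfl⟩
  rw [this]
  exact (isOpen_discrete _).preimage ((continuous_apply 0).comp continuous_chainAt_val)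

/-- The space of chains ending at `a` is a disjoint union of open copies of spaces of chains, one
for each first link, so continuity can be checked on each copy. -/
theorem ChainAt.continuous_of_cons {T : Type*} [TopologicalSpace T] {a : A} {g : ChainAt M a → T}
    (h : ∀ (b : A) (m : (M.obj a).obj (op b)), Continuous fun q => g (ChainAt.cons m q)) :
    Continuous g := by
  refine continuous_iff_continuousAt.2 fun p => ?_
  obtain ⟨b, m, q, rfl⟩ := p.exists_cons
  exact (ChainAt.isOpenEmbedding_cons m).continuousAt_iff.1 (h b m).continuousAt

/-- By terminality of `I`, each chain determines a single element of `I`. -/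
theorem IsTerminalCoalgebra.existsUnique_point (hI : IsTerminalCoalgebra I) {a : A}
    (p : ChainAt M a) : ∃! y : I.V.obj a, ∃ x, Follows I p.1 x ∧ x 0 = ⟨a, y⟩ := by
  obtain ⟨x, hx⟩ := hI.exists_follows p.2.1
  have h0 : ∃ y : I.V.obj a, x 0 = ⟨a, y⟩ := by
    have := (hx.tgt 0).symm.trans p.2.2
    subst this
    exact ⟨(x 0).2, rfl⟩
  obtain ⟨y, hy⟩ := h0
  refine ⟨y, ⟨x, hx, hy⟩, ?_⟩
  rintro y' ⟨x', hx', hy'⟩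
  rw [hI.follows_unique p.2.1 hx' hx, hy] at hy'
  exact (eq_of_heq (Sigma.mk.inj hy').2).symm

/-- The point of a terminal coalgebra given by a chain: the first term of the only sequence of
elements that unfolds along the chain. -/
noncomputable def chainPoint (hI : IsTerminalCoalgebra I) {a : A} (p : ChainAt M a) : I.V.obj a :=
  (hI.existsUnique_point p).choose

theorem chainPoint_eq (hI : IsTerminalCoalgebra I) {a : A} {p : ChainAt M a}
    {x : ℕ → Σ a : A, I.V.obj a} (hx : Follows I p.1 x) {y : I.V.obj a} (hy : x 0 = ⟨a, y⟩) :
    chainPoint hI p = y :=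
  (hI.existsUnique_point p).unique (hI.existsUnique_point p).choose_spec.1 ⟨x, hx, hy⟩

theorem exists_follows_chainPoint (hI : IsTerminalCoalgebra I) {a : A} (p : ChainAt M a) :
    ∃ x, Follows I p.1 x ∧ x 0 = ⟨a, chainPoint hI p⟩ :=
  (hI.existsUnique_point p).choose_spec.1

theorem chainPoint_cons_eq (hI : IsTerminalCoalgebra I) {a b : A} {m : (M.obj a).obj (op b)}
    {q : ChainAt M b} {y : I.V.obj a} (h : Unfolds I m y (chainPoint hI q)) :
    chainPoint hI (ChainAt.cons m q) = y := by
  obtain ⟨x, hx, h0⟩ := exists_follows_chainPoint hI q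
  refine chainPoint_eq hI (x := fun n => Nat.casesOn n ⟨a, y⟩ x) (fun n => ?_) rfl
  cases n with
  | zero =>
    change LinkUnfolds I ⟨a, b, m⟩ ⟨a, y⟩ (x 0)
    rw [h0]
    exact .mk h
  | succ n => exact hx n

theorem unfolds_chainPoint_cons (hI : IsTerminalCoalgebra I) {a b : A} (m : (M.obj a).obj (op b))
    (q : ChainAt M b) : Unfolds I m (chainPoint hI (ChainAt.cons m q)) (chainPoint hI q) := by
  obtain ⟨x, hx, h0⟩ := exists_follows_chainPoint hI (ChainAt.cons m q)
  have h := hx 0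
  obtain ⟨y, hy⟩ : ∃ y : I.V.obj b, x 1 = ⟨b, y⟩ := by
    have : b = (x 1).1 := q.2.2.symm.trans (hx.tgt 1)
    subst this
    exact ⟨_, rfl⟩
  rw [chainPoint_eq hI (p := q) (x := fun n => x (n + 1)) (fun n => hx (n + 1)) hy]
  rw [h0, zero_add, hy] at h
  exact linkUnfolds_iff.1 h

theorem chainPoint_surjective (hI : IsTerminalCoalgebra I) (a : A) :
    Function.Surjective (chainPoint hI : ChainAt M a → I.V.obj a) := by
  intro y
  obtain ⟨x, hx, h0⟩ := exists_run (C := I) ⟨a, y⟩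
  choose m hm using hx
  have hf : Follows I (fun n => ⟨_, _, m n⟩) x := fun n => .mk (hm n)
  exact ⟨⟨_, hf.isChain, congrArg Sigma.fst h0⟩, chainPoint_eq hI hf h0⟩

end Terminal

/-! ### Chains with the same point -/

section General

/-- Kőnig's lemma: in a finitely branching graded relation, a vertex from which there are paths of
every finite length is the start of an infinite path. -/
theorem exists_infinite_path {Z : Type*} (R : ℕ → Z → Z → Prop)
    (hfin : ∀ n z, {z' | R n z z'}.Finite) (z₀ : Z)
    (h : ∀ k, ∃ f : ℕ → Z, f 0 = z₀ ∧ ∀ n < k, R n (f n) (f (n + 1))) :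
    ∃ f : ℕ → Z, f 0 = z₀ ∧ ∀ n, R n (f n) (f (n + 1)) := by
  let G : ℕ → Z → Prop := fun n z =>
    ∀ k, ∃ f : ℕ → Z, f n = z ∧ ∀ i, n ≤ i → i < k → R i (f i) (f (i + 1))
  have step : ∀ n z, G n z → ∃ z', R n z z' ∧ G (n + 1) z' := by
    intro n z hz
    by_contra! hno
    have hbad : ∀ z', ∃ k, R n z z' →
        ¬ ∃ f : ℕ → Z, f (n + 1) = z' ∧ ∀ i, n + 1 ≤ i → i < k → R i (f i) (f (i + 1)) := by
      intro z'
      by_cases hR : R n z z'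
      · obtain ⟨k, hk⟩ := not_forall.1 (hno z' hR)
        exact ⟨k, fun _ => hk⟩
      · exact ⟨0, fun h => absurd h hR⟩
    choose k hk using hbad
    obtain ⟨K, hK⟩ := ((hfin n z).image k).bddAbove
    obtain ⟨f, hf, hR⟩ := hz (max K (n + 1))
    have h1 : R n z (f (n + 1)) := hf ▸ hR n le_rfl (lt_max_of_lt_right n.lt_succ_self)
    exact hk _ h1 ⟨f, rfl, fun i hi hik => hR i (by omega)
      (lt_max_of_lt_left (lt_of_lt_of_le hik (hK ⟨_, h1, rfl⟩)))⟩
  choose! next hnext using step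
  let f : ℕ → Z := fun n => Nat.rec z₀ (fun n z => next n z) n
  have hG : ∀ n, G n (f n) := by
    intro n
    induction n with
    | zero =>
      intro k
      obtain ⟨f, h0, hf⟩ := h k
      exact ⟨f, h0, fun i _ hi => hf i hi⟩
    | succ n ih => exact (hnext n _ ih).2
  exact ⟨f, rfl, fun n => (hnext n _ (hG n)).1⟩

/-- A quotient of a compact Hausdorff space by a closed equivalence relation is Hausdorff. -/
theorem t2Space_of_isClosed_ker {T T' : Type*} [TopologicalSpace T] [TopologicalSpace T']
    [CompactSpace T] [T2Space T] {f : T → T'} (hf : Topology.IsQuotientMap f)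
    (hR : IsClosed {p : T × T | f p.1 = f p.2}) : T2Space T' := by
  have hcl : IsClosedMap f := by
    intro K hK
    rw [← hf.isClosed_preimage]
    have : f ⁻¹' (f '' K) = Prod.snd '' ({p : T × T | f p.1 = f p.2} ∩ Prod.fst ⁻¹' K) := by
      ext x
      constructor
      · rintro ⟨y, hy, h⟩
        exact ⟨(y, x), ⟨h, hy⟩, rfl⟩
      · rintro ⟨⟨y, x⟩, ⟨h, hy⟩, rfl⟩
        exact ⟨y, hy, h⟩
    rw [this]
    exact isClosedMap_snd_of_compactSpace _ (hR.inter (hK.preimage continuous_fst))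
  have hpt : ∀ y : T', IsClosed {y} := by
    intro y
    obtain ⟨x, rfl⟩ := hf.surjective y
    rw [← Set.image_singleton]
    exact hcl _ (isClosed_singleton (x := x))
  refine ⟨fun y y' hne => ?_⟩
  have hd : Disjoint (f ⁻¹' {y}) (f ⁻¹' {y'}) :=
    (Set.disjoint_singleton.2 hne).preimage f
  obtain ⟨U, V, hU, hV, hyU, hyV, hUV⟩ := SeparatedNhds.of_isCompact_isCompact
    ((hpt y).preimage hf.continuous).isCompact ((hpt y').preimage hf.continuous).isCompact hd
  refine ⟨(f '' Uᶜ)ᶜ, (f '' Vᶜ)ᶜ, (hcl _ hU.isClosed_compl).isOpen_compl,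
    (hcl _ hV.isClosed_compl).isOpen_compl, ?_, ?_, ?_⟩
  · rintro ⟨x, hx, h⟩
    exact hx (hyU h)
  · rintro ⟨x, hx, h⟩
    exact hx (hyV h)
  · refine Set.disjoint_left.2 fun z hz hz' => ?_
    obtain ⟨x, rfl⟩ := hf.surjective z
    exact Set.disjoint_left.1 hUV (by_contra fun h => hz ⟨x, h, rfl⟩)
      (by_contra fun h => hz' ⟨x, h, rfl⟩)

end General

section Spans

open Topology

variable {A : Type u} [SmallCategory A] {M : Profunctor.{u} A A}
  {C I : Endofunctor.Coalgebra (moduleTensor M)}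

variable (A) in
/-- A span in the category `A`. -/
structure SpanState : Type u where
  /-- the apex -/
  apex : A
  /-- the codomain of the left leg -/
  left : A
  /-- the codomain of the right leg -/
  right : A
  /-- the left leg -/
  fst : apex ⟶ left
  /-- the right leg -/
  snd : apex ⟶ right

/-- One step of a span from one chain to two others: given links `m` and `n` and spans with legs
`f`, `f'` and `g`, `g'`, there is an element `p` of the module with `f p = m g` and
`f' p = n g'`. -/
inductive SpanStep : Link M → Link M → SpanState A → SpanState A → Prop
  | mk {a b c a₁ b₁ c₁ : A} {m : (M.obj a).obj (op a₁)} {n : (M.obj b).obj (op b₁)}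
      {f : c ⟶ a} {f' : c ⟶ b} {g : c₁ ⟶ a₁} {g' : c₁ ⟶ b₁} (p : (M.obj c).obj (op c₁))
      (h : (M.map f).app (op c₁) p = (M.obj a).map g.op m)
      (h' : (M.map f').app (op c₁) p = (M.obj b).map g'.op n) :
      SpanStep ⟨a, a₁, m⟩ ⟨b, b₁, n⟩ ⟨c, a, b, f, f'⟩ ⟨c₁, a₁, b₁, g, g'⟩

theorem finite_setOf_spanStep (hM : ∀ a, FinitePresheaf (M.obj a)) (l l' : Link M)
    (z : SpanState A) : {z' | SpanStep l l' z z'}.Finite := by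
  obtain h | ⟨z', hz'⟩ := {z' | SpanStep l l' z z'}.eq_empty_or_nonempty
  · rw [h]
    exact Set.finite_empty
  obtain @⟨a, b, c, a₁, b₁, -, m, n, f, f', -, -, -, -, -⟩ := hz'
  have := (hM c).1
  have := (hM a).2
  have := (hM b).2
  refine (Set.finite_range fun e : Σ e : (M.obj c).Elements,
    ((M.obj a).elementsMk (op a₁) m ⟶ (M.obj a).elementsMk e.1 ((M.map f).app e.1 e.2)) ×
      ((M.obj b).elementsMk (op b₁) n ⟶ (M.obj b).elementsMk e.1 ((M.map f').app e.1 e.2)) =>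
    (⟨e.1.1.unop, a₁, b₁, e.2.1.1.unop, e.2.2.1.unop⟩ : SpanState A)).subset ?_
  intro z'' h
  cases h with
  | mk p h h' => exact ⟨⟨(M.obj c).elementsMk (op _) p, ⟨_, h.symm⟩, ⟨_, h'.symm⟩⟩, rfl⟩

/-- The legs of the span `z` send a common element to `x` and `y`. -/
inductive Refines (C : Endofunctor.Coalgebra (moduleTensor M)) :
    SpanState A → (Σ a : A, C.V.obj a) → (Σ a : A, C.V.obj a) → Prop
  | mk {a b c : A} {f : c ⟶ a} {f' : c ⟶ b} (w : C.V.obj c) :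
      Refines C ⟨c, a, b, f, f'⟩ ⟨a, C.V.map f w⟩ ⟨b, C.V.map f' w⟩

theorem Refines.exists_step (hC : NondegenerateTop C.V) {l l' : Link M} {z : SpanState A}
    {x y x₁ y₁ : Σ a : A, C.V.obj a} (h : Refines C z x y) (hx : LinkUnfolds C l x x₁)
    (hy : LinkUnfolds C l' y y₁) : ∃ z', SpanStep l l' z z' ∧ Refines C z' x₁ y₁ := by
  obtain ⟨w⟩ := h
  obtain ⟨hx⟩ := hx
  obtain ⟨hy⟩ := hy
  obtain ⟨c₁, p, g, g', w₁, -, h1, h2, rfl, rfl⟩ := hx.exists_span hC hy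
  exact ⟨_, .mk p h1 h2, .mk w₁⟩

theorem Refines.exists_path (hC : NondegenerateTop C.V) {s t : ℕ → Link M}
    {x y : ℕ → Σ a : A, C.V.obj a} (hx : Follows C s x) (hy : Follows C t y) {z₀ : SpanState A}
    (h : Refines C z₀ (x 0) (y 0)) :
    ∃ z : ℕ → SpanState A, z 0 = z₀ ∧ ∀ n, SpanStep (s n) (t n) (z n) (z (n + 1)) := by
  have step : ∀ n z, Refines C z (x n) (y n) →
      ∃ z', SpanStep (s n) (t n) z z' ∧ Refines C z' (x (n + 1)) (y (n + 1)) :=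
    fun n z hz => hz.exists_step hC (hx n) (hy n)
  have : Nonempty (SpanState A) := ⟨z₀⟩
  choose! next hnext using step
  let z : ℕ → SpanState A := fun n => Nat.rec z₀ (fun n z => next n z) n
  have hz : ∀ n, Refines C (z n) (x n) (y n) := by
    intro n
    induction n with
    | zero => exact h
    | succ n ih => exact (hnext n _ ih).2
  exact ⟨z, rfl, fun n => (hnext n _ (hz n)).1⟩

theorem SpanStep.exists_linkUnfolds {l l' : Link M} {z z' : SpanState A}
    (h : SpanStep l l' z z') : ∃ p : (M.obj z.apex).obj (op z'.apex),
      ∀ (C : Endofunctor.Coalgebra (moduleTensor M)) (w : C.V.obj z.apex) (w' : C.V.obj z'.apex),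
        Unfolds C p w w' →
          LinkUnfolds C l ⟨z.left, C.V.map z.fst w⟩ ⟨z'.left, C.V.map z'.fst w'⟩ ∧
            LinkUnfolds C l' ⟨z.right, C.V.map z.snd w⟩ ⟨z'.right, C.V.map z'.snd w'⟩ := by
  obtain ⟨p, h, h'⟩ := h
  refine ⟨p, fun C w w' hw => ⟨.mk ?_, .mk ?_⟩⟩
  · rw [← unfolds_map_iff, ← h]
    exact hw.map _
  · rw [← unfolds_map_iff, ← h']
    exact hw.map _

/-- Chains spanned by a third chain have the same point, since the points of the third chain map to
sequences unfolding along the given ones. -/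
theorem chainPoint_eq_of_path (hI : IsTerminalCoalgebra I) {a : A} {p q : ChainAt M a}
    {z : ℕ → SpanState A} (h0 : z 0 = ⟨a, a, a, 𝟙 a, 𝟙 a⟩)
    (hz : ∀ n, SpanStep (p.1 n) (q.1 n) (z n) (z (n + 1))) : chainPoint hI p = chainPoint hI q := by
  choose m hm using fun n => (hz n).exists_linkUnfolds
  obtain ⟨w, hw⟩ := hI.exists_unfolds_chain (fun n => (z n).apex) m
  have h := fun n => hm n I _ _ (hw n)
  have hl : ∃ y : I.V.obj a, (⟨(z 0).left, I.V.map (z 0).fst (w 0)⟩ : Σ a : A, I.V.obj a) = ⟨a, y⟩ ∧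
      (⟨(z 0).right, I.V.map (z 0).snd (w 0)⟩ : Σ a : A, I.V.obj a) = ⟨a, y⟩ := by
    generalize w 0 = w₀
    generalize z 0 = z₀ at w₀ h0
    subst h0
    exact ⟨w₀, by simp, by simp⟩
  obtain ⟨y, h1, h2⟩ := hl
  rw [chainPoint_eq hI (x := fun n => ⟨(z n).left, I.V.map (z n).fst (w n)⟩)
    (fun n => (h n).1) h1, chainPoint_eq hI
    (x := fun n => ⟨(z n).right, I.V.map (z n).snd (w n)⟩) (fun n => (h n).2) h2]

theorem isOpen_setOf_agree {a : A} (p : ChainAt M a) (k : ℕ) :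
    IsOpen {q : ChainAt M a | ∀ n < k, q.1 n = p.1 n} := by
  have : {q : ChainAt M a | ∀ n < k, q.1 n = p.1 n} =
      ⋂ n ∈ Set.Iio k, (fun q : ChainAt M a => q.1 n) ⁻¹' {p.1 n} := by
    ext q
    rw [Set.mem_iInter₂]
    rfl
  rw [this]
  exact (Set.finite_Iio k).isOpen_biInter fun n _ =>
    (isOpen_discrete _).preimage ((continuous_apply n).comp continuous_chainAt_val)

/-- The relation of having the same point is closed: chains in its closure have spans of every
finite length between them, hence, by Kőnig's lemma, an infinite one. -/
theorem isClosed_setOf_chainPoint_eq (hI : IsTerminalCoalgebra I) (a : A) :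
    IsClosed {r : ChainAt M a × ChainAt M a | chainPoint hI r.1 = chainPoint hI r.2} := by
  refine isClosed_of_closure_subset ?_
  rintro ⟨p, q⟩ hpq
  obtain ⟨z, h0, hz⟩ := exists_infinite_path (fun n => SpanStep (p.1 n) (q.1 n))
    (fun n z => finite_setOf_spanStep hI.finite _ _ z) ⟨a, a, a, 𝟙 a, 𝟙 a⟩ (by
      intro k
      obtain ⟨⟨p', q'⟩, ⟨hp', hq'⟩, he⟩ := mem_closure_iff.1 hpq _
        ((isOpen_setOf_agree p k).prod (isOpen_setOf_agree q k))
        ⟨fun _ _ => rfl, fun _ _ => rfl⟩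
      obtain ⟨x, hx, hx0⟩ := exists_follows_chainPoint hI p'
      obtain ⟨y, hy, hy0⟩ := exists_follows_chainPoint hI q'
      have he : chainPoint hI p' = chainPoint hI q' := he
      obtain ⟨z, h0, hz⟩ := Refines.exists_path hI.nondegenerate hx hy
        (z₀ := ⟨a, a, a, 𝟙 a, 𝟙 a⟩) (by
          rw [hx0, hy0, he]
          simpa using Refines.mk (C := I) (f := 𝟙 a) (f' := 𝟙 a) (chainPoint hI q'))
      refine ⟨z, h0, fun n hn => ?_⟩
      rw [← hp' n hn, ← hq' n hn]
      exact hz n)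
  exact chainPoint_eq_of_path hI h0 hz

end Spans

/-! ### The quotient topology on a terminal coalgebra -/

section Quotient

open Topology

variable {A : Type u} [SmallCategory A] {M : Profunctor.{u} A A}
  {I : Endofunctor.Coalgebra (moduleTensor M)}

/-- The set underlying a component of a terminal coalgebra, to be given the quotient topology from
the space of chains. -/
def ChainQuotient (_ : IsTerminalCoalgebra I) (a : A) : Type u :=
  I.V.obj a

variable (hI : IsTerminalCoalgebra I)

/-- The map from chains to points, with values in the quotient space. -/
noncomputable def chainProj (a : A) (p : ChainAt M a) : ChainQuotient hI a :=
  chainPoint hI p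

noncomputable instance (a : A) : TopologicalSpace (ChainQuotient hI a) :=
  TopologicalSpace.coinduced (chainProj hI a) inferInstance

theorem isQuotientMap_chainProj (a : A) : IsQuotientMap (chainProj hI a) :=
  ⟨⟨rfl⟩, chainPoint_surjective hI a⟩

instance (a : A) : CompactSpace (ChainQuotient hI a) := by
  have := compactSpace_chainAt hI.finite a
  exact (isQuotientMap_chainProj hI a).surjective.compactSpace
    (isQuotientMap_chainProj hI a).continuous

instance (a : A) : T2Space (ChainQuotient hI a) := by
  have := compactSpace_chainAt hI.finite a
  exact t2Space_of_isClosed_ker (isQuotientMap_chainProj hI a) (isClosed_setOf_chainPoint_eq hI a)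

theorem continuous_chainQuotient {T : Type*} [TopologicalSpace T] {a : A}
    {g : ChainQuotient hI a → T}
    (h : ∀ (b : A) (m : (M.obj a).obj (op b)),
      Continuous fun q => g (chainProj hI a (ChainAt.cons m q))) : Continuous g :=
  (isQuotientMap_chainProj hI a).continuous_iff.2 (ChainAt.continuous_of_cons h)

/-- The functor of quotients of the spaces of chains. -/
noncomputable def quotientFunctor : A ⥤ TopCat.{u} where
  obj a := TopCat.of (ChainQuotient hI a)
  map {a a'} f := TopCat.ofHom
    { toFun := fun x : ChainQuotient hI a => (I.V.map f x : ChainQuotient hI a')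
      continuous_toFun := by
        refine continuous_chainQuotient hI fun b m => ?_
        refine ((isQuotientMap_chainProj hI a').continuous.comp
          (ChainAt.isOpenEmbedding_cons ((M.map f).app (op b) m)).continuous).congr fun q => ?_
        exact chainPoint_cons_eq hI ((unfolds_chainPoint_cons hI m q).map f) }
  map_id a := by
    ext x
    exact ConcreteCategory.congr_hom (I.V.map_id a) x
  map_comp f g := by
    ext x
    exact ConcreteCategory.congr_hom (I.V.map_comp f g) x

theorem nondegenerateTop_quotientFunctor : NondegenerateTop (quotientFunctor hI) := by
  have h := hI.nondegenerate.1.componentwiseFlat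
  refine ⟨ComponentwiseFlat.nondegenerate ⟨h.exists_span, h.exists_eq⟩, fun a a' f => ?_⟩
  have : CompactSpace ((quotientFunctor hI).obj a) :=
    inferInstanceAs (CompactSpace (ChainQuotient hI a))
  have : T2Space ((quotientFunctor hI).obj a') := inferInstanceAs (T2Space (ChainQuotient hI a'))
  exact ((quotientFunctor hI).map f).hom.continuous.isClosedMap

/-- The identity: retopologizing does not change the set underlying a tensor product. -/
def tensorQuotient {Y : Aᵒᵖ ⥤ Type u} (t : Tensor Y (I.V ⋙ forget TopCat.{u})) :
    Tensor Y (quotientFunctor hI ⋙ forget TopCat.{u}) :=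
  t

/-- A terminal coalgebra with its components retopologized as quotients of spaces of chains. -/
noncomputable def quotientCoalgebra : Endofunctor.Coalgebra (moduleTensor M) where
  V := quotientFunctor hI
  str :=
    { app := fun a => TopCat.ofHom
        { toFun := fun x : ChainQuotient hI a => tensorQuotient hI (Y := M.obj a) (I.str.app a x)
          continuous_toFun := by
            refine continuous_chainQuotient hI fun b m => ?_
            have hc : Continuous fun x : ChainQuotient hI b =>
                (Tensor.mk m x : Tensor (M.obj a) (quotientFunctor hI ⋙ forget TopCat.{u})) :=
              continuous_coinduced_rng.comp (continuous_sigmaMk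
                (σ := fun p : (Σ b : A, (M.obj a).obj (op b)) =>
                  (quotientFunctor hI ⋙ forget TopCat.{u}).obj p.1) (i := ⟨b, m⟩))
            refine (hc.comp (isQuotientMap_chainProj hI b).continuous).congr fun q => ?_
            exact (unfolds_chainPoint_cons hI m q).symm }
      naturality := fun a a' f => by
        ext x
        exact ConcreteCategory.congr_hom (I.str.naturality f) x }

theorem unfolds_quotientCoalgebra_iff {a b : A} (m : (M.obj a).obj (op b)) (x : I.V.obj a)
    (y : I.V.obj b) : Unfolds (quotientCoalgebra hI) m x y ↔ Unfolds I m x y :=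
  Iff.rfl

/-- Elements near to order `k` are the points of chains that agree in the first `k` places. -/
theorem exists_agree_of_near {k : ℕ} {a : A} {x x' : (quotientCoalgebra hI).V.obj a}
    (h : Near (quotientCoalgebra hI) k x x') :
    ∃ p q : ChainAt M a, chainProj hI a p = x ∧ chainProj hI a q = x' ∧
      ∀ n < k, p.1 n = q.1 n := by
  induction k generalizing a with
  | zero =>
    obtain ⟨p, rfl⟩ := chainPoint_surjective hI a x
    obtain ⟨q, rfl⟩ := chainPoint_surjective hI a x'
    exact ⟨p, q, rfl, rfl, fun n hn => absurd hn n.not_lt_zero⟩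
  | succ k ih =>
    obtain ⟨b, m, y, y', h1, h2, h3⟩ := h
    obtain ⟨p, q, rfl, rfl, hpq⟩ := ih h3
    refine ⟨ChainAt.cons m p, ChainAt.cons m q, chainPoint_cons_eq hI h1,
      chainPoint_cons_eq hI h2, fun n hn => ?_⟩
    cases n with
    | zero => rfl
    | succ n => exact hpq n (by omega)

/-- Otherwise, for every `k`, some chain with point `x` would agree in the first `k` places with a
chain whose point lies outside `U`; by compactness, some chain would have both properties. -/
theorem shrinking_quotientCoalgebra : Shrinking (quotientCoalgebra hI) := by
  intro a x U hU
  obtain ⟨V, hVU, hV, hxV⟩ := mem_nhds_iff.1 hU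
  have := compactSpace_chainAt hI.finite a
  have hc := (isQuotientMap_chainProj hI a).continuous
  let B : ℕ → Set (ChainAt M a × ChainAt M a) := fun k =>
    {r | chainProj hI a r.1 = x ∧ chainProj hI a r.2 ∉ V ∧ ∀ n < k, r.1.1 n = r.2.1 n}
  have hB : ∀ k, IsClosed (B k) := by
    intro k
    have h1 : IsClosed {r : ChainAt M a × ChainAt M a | chainProj hI a r.1 = x} :=
      isClosed_eq (hc.comp continuous_fst) continuous_const
    have h2 : IsClosed {r : ChainAt M a × ChainAt M a | chainProj hI a r.2 ∉ V} :=
      hV.isClosed_compl.preimage (hc.comp continuous_snd)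
    have h3 : IsClosed {r : ChainAt M a × ChainAt M a | ∀ n < k, r.1.1 n = r.2.1 n} := by
      simp only [Set.ofPred_forall]
      exact isClosed_biInter fun n _ => isClosed_eq
        ((continuous_apply n).comp (continuous_chainAt_val.comp continuous_fst))
        ((continuous_apply n).comp (continuous_chainAt_val.comp continuous_snd))
    exact h1.inter (h2.inter h3)
  by_contra! hno
  obtain ⟨⟨p, q⟩, hpq⟩ := IsCompact.nonempty_iInter_of_sequence_nonempty_isCompact_isClosed B
    (fun k r hr => ⟨hr.1, hr.2.1, fun n hn => hr.2.2 n (by omega)⟩)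
    (fun k => by
      obtain ⟨x', h, hx'⟩ := hno k
      obtain ⟨p, q, hp, rfl, hpq⟩ := exists_agree_of_near hI h
      exact ⟨(p, q), hp, fun hq => hx' (hVU hq), hpq⟩)
    (hB 0).isCompact hB
  rw [Set.mem_iInter] at hpq
  obtain rfl : p = q := Subtype.ext (funext fun n => (hpq (n + 1)).2.2 n n.lt_succ_self)
  exact (hpq 0).2.1 ((hpq 0).1 ▸ hxV)

/-- A map from the retopologized coalgebra to `I` is the identity, since it preserves the sequences
that unfold along a given chain, and these are unique. -/
theorem quotientCoalgebra_hom_apply (β : quotientCoalgebra hI ⟶ I) {a : A} (x : I.V.obj a) :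
    β.f.app a x = x := by
  obtain ⟨p, rfl⟩ := chainPoint_surjective hI a x
  obtain ⟨f, hf, h0⟩ := exists_follows_chainPoint hI p
  refine (chainPoint_eq hI (p := p) (x := fun n => ⟨(f n).1, β.f.app (f n).1 (f n).2⟩)
    (fun n => ?_) ?_).symm
  · dsimp only
    have h := hf n
    generalize p.1 n = l, f n = y, f (n + 1) = y' at h
    obtain ⟨h⟩ := h
    exact .mk (((unfolds_quotientCoalgebra_iff hI _ _ _).2 h).hom β)
  · dsimp only
    rw [h0]

/-- The quotient topology on a terminal coalgebra is its original topology: one inclusion comes from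
terminality, the other from continuity of maps into a shrinking coalgebra. -/
noncomputable def quotientHomeomorph (a : A) : I.V.obj a ≃ₜ ChainQuotient hI a where
  toFun x := x
  invFun x := x
  left_inv _ := rfl
  right_inv _ := rfl
  continuous_toFun := (shrinking_quotientCoalgebra hI).continuous hI.finite hI.nondegenerate
    (C := I) (α := fun _ x => x) (fun _ _ m x y h => (unfolds_quotientCoalgebra_iff hI m x y).2 h) a
  continuous_invFun := by
    obtain ⟨β⟩ := hI.exists_hom (quotientCoalgebra hI) (nondegenerateTop_quotientFunctor hI)
    exact (β.f.app a).hom.continuous.congr fun x => quotientCoalgebra_hom_apply hI β x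

theorem IsTerminalCoalgebra.compactSpace (hI : IsTerminalCoalgebra I) (a : A) :
    CompactSpace (I.V.obj a) :=
  (quotientHomeomorph hI a).symm.compactSpace

theorem IsTerminalCoalgebra.metrizableSpace (hI : IsTerminalCoalgebra I) (a : A) :
    TopologicalSpace.MetrizableSpace (I.V.obj a) := by
  have : SecondCountableTopology (ChainQuotient hI a) :=
    (shrinking_quotientCoalgebra hI).secondCountableTopology hI.finite
      (nondegenerateTop_quotientFunctor hI) a
  exact (quotientHomeomorph hI a).isEmbedding.metrizableSpace

theorem Realizable.compactSpace_and_metrizableSpace {S : Type u} [TopologicalSpace S]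
    (h : Realizable S) : CompactSpace S ∧ TopologicalSpace.MetrizableSpace S := by
  obtain ⟨E, I, ⟨ht⟩, a, ⟨e⟩⟩ := h
  have hI : IsTerminalCoalgebra I.obj :=
    { finite := E.finite
      nondegenerate := I.property
      exists_hom := fun C hC => ⟨(ht.from (⟨C, hC⟩ : E.CoalgTop)).hom⟩
      hom_unique := fun C hC f g => congrArg InducedCategory.Hom.hom
        (ht.hom_ext (ObjectProperty.homMk f : (⟨C, hC⟩ : E.CoalgTop) ⟶ I)
          (ObjectProperty.homMk g)) }
  have := hI.compactSpace a
  have := hI.metrizableSpace a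
  exact ⟨e.symm.compactSpace, e.isEmbedding.metrizableSpace⟩

end Quotient
end SelfSimilarity

theorem theoremC1 (S : Type u) [TopologicalSpace S] :
    SelfSimilarity.Realizable S ↔
      CompactSpace S ∧ TopologicalSpace.MetrizableSpace S := by
  refine ⟨SelfSimilarity.Realizable.compactSpace_and_metrizableSpace, fun ⟨_, _⟩ => ?_⟩
  let := TopologicalSpace.metrizableSpaceMetric S
  exact SelfSimilarity.realizable_of_compact_metric S
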